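/- Over $\mathrm{WKL}_0$, weak Martin's pointed tree theorem ($\mathrm{wMPT}$) does not imply $\mathrm{ACA}_0$; this is witnessed by an $\omega$-model generated by a $\ll$-chain of hyperimmune-free reals. Definitions. $\mathrm{wMPT}$ is the statement that if $T\subseteq\omega^{<\omega}$ is a tree (a set of finite strings closed under initial segments) whose set of infinite paths $[T]$ is cofinal, i.e. for every real $z\in\omega^\omega$ there is $x\in[T]$ with $z\le_{\rm T}x$, then $T$ has a perfect subtree (a nonempty tree $S\subseteq T$ in which every node has two incompatible extensions). It holds in an $\omega$-model with second-order part $I\subseteq\mathcal P(\omega)$ if it holds with all of $T,z,x,S$ ranging over objects whose standard codes as sets of natural numbers are in $I$. A real $x$ is hyperimmune-free if every $x$-recursive function is dominated by a recursive function. We write $y\ll x$ if there is $z\in 2^\omega$ with $z\le_{\rm T}x$ and $z(e)\neq\Phi^y_e(e)$ for all $e$ (where the condition on $e$ holds if $\Phi^y_e(e)$ is undefined). Theorem. (1) There is a sequence $x_0=\emptyset\ll x_1\ll x_2\ll\cdots$ of hyperimmune-free reals such that the $\omega$-model $\mathcal M$ with second-order part $\{A\subseteq\omega : \exists n\ (A\le_{\rm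 T}x_n)\}$ is a model of $\mathrm{WKL}_0$ in which $\mathrm{wMPT}$ holds, but $\mathcal M$ is not a model of $\mathrm{ACA}_0$. (2) Consequently, $\mathrm{WKL}_0+\mathrm{wMPT}$ does not logically imply $\mathrm{ACA}_0$: whenever $\varphi$ is a formula of second-order arithmetic (read as its universal closure) that formalizes $\mathrm{wMPT}$, in the sense that an $\omega$-model of $\mathrm{RCA}_0$ satisfies $\varphi$ if and only if $\mathrm{wMPT}$ holds in it, there is a model of $\mathrm{WKL}_0+\varphi$ that is not a model of $\mathrm{ACA}_0$. -/

import Mathlib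

open scoped Computability

/-! ### Second-order arithmetic: syntax and semantics -/

/-- A structure for the (two-sorted) language of second-order arithmetic: a first-order part `N`
with `0, 1, +, ·, <`, and a nonempty collection of subsets of `N` over which the set variables
range. -/
structure L2Structure where
  N : Type
  zero : N
  one : N
  add : N → N → N
  mul : N → N → N
  lt : N → N → Prop
  sets : Set (Set N)
  sets_nonempty : sets.Nonempty

/-- Numerical terms; `var i` is the `i`-th number variable. -/
inductive L2Term : Type
  | var (i : ℕ)
  | zero
  | one
  | add (s t : L2Term)
  | mul (s t : L2Term)

/-- Formulas; `mem t X` says that `t` belongs to the `X`-th set variable, `all x`, `ex x` bind the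
`x`-th number variable and `allSet X`, `exSet X` bind the `X`-th set variable. -/
inductive L2Formula : Type
  | eq (s t : L2Term)
  | lt (s t : L2Term)
  | mem (t : L2Term) (X : ℕ)
  | not (φ : L2Formula)
  | and (φ ψ : L2Formula)
  | or (φ ψ : L2Formula)
  | imp (φ ψ : L2Formula)
  | all (x : ℕ) (φ : L2Formula)
  | ex (x : ℕ) (φ : L2Formula)
  | allSet (X : ℕ) (φ : L2Formula)
  | exSet (X : ℕ) (φ : L2Formula)

/-- `i` is one of the variables of the term. -/
def L2Term.HasVar (i : ℕ) : L2Term → Prop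
  | .var j => i = j
  | .zero => False
  | .one => False
  | .add s t => s.HasVar i ∨ t.HasVar i
  | .mul s t => s.HasVar i ∨ t.HasVar i

def L2Term.eval (M : L2Structure) (v : ℕ → M.N) : L2Term → M.N
  | .var i => v i
  | .zero => M.zero
  | .one => M.one
  | .add s t => M.add (s.eval M v) (t.eval M v)
  | .mul s t => M.mul (s.eval M v) (t.eval M v)

/-- Satisfaction of a formula under the assignment `v` of the number variables and the
assignment `V` of the set variables. -/
def L2Formula.Sat (M : L2Structure) : L2Formula → (ℕ → M.N) → (ℕ → Set M.N) → Prop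
  | .eq s t, v, _ => s.eval M v = t.eval M v
  | .lt s t, v, _ => M.lt (s.eval M v) (t.eval M v)
  | .mem t X, v, V => t.eval M v ∈ V X
  | .not φ, v, V => ¬ φ.Sat M v V
  | .and φ ψ, v, V => φ.Sat M v V ∧ ψ.Sat M v V
  | .or φ ψ, v, V => φ.Sat M v V ∨ ψ.Sat M v V
  | .imp φ ψ, v, V => φ.Sat M v V → ψ.Sat M v V
  | .all x φ, v, V => ∀ n : M.N, φ.Sat M (Function.update v x n) V
  | .ex x φ, v, V => ∃ n : M.N, φ.Sat M (Function.update v x n) V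
  | .allSet X φ, v, V => ∀ A ∈ M.sets, φ.Sat M v (Function.update V X A)
  | .exSet X φ, v, V => ∃ A ∈ M.sets, φ.Sat M v (Function.update V X A)

/-- `M ⊨ φ` (for a formula with free variables: `M` satisfies its universal closure). -/
def L2Structure.Models (M : L2Structure) (φ : L2Formula) : Prop :=
  ∀ (v : ℕ → M.N) (V : ℕ → Set M.N), (∀ i, V i ∈ M.sets) → φ.Sat M v V

/-- Formulas all of whose quantifiers are bounded number quantifiers `∀ x < t`, `∃ x < t`, with `x`
not in `t`. -/
inductive L2Formula.IsBounded : L2Formula → Prop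
  | eq (s t : L2Term) : IsBounded (.eq s t)
  | lt (s t : L2Term) : IsBounded (.lt s t)
  | mem (t : L2Term) (X : ℕ) : IsBounded (.mem t X)
  | not {φ : L2Formula} : IsBounded φ → IsBounded (.not φ)
  | and {φ ψ : L2Formula} : IsBounded φ → IsBounded ψ → IsBounded (.and φ ψ)
  | or {φ ψ : L2Formula} : IsBounded φ → IsBounded ψ → IsBounded (.or φ ψ)
  | imp {φ ψ : L2Formula} : IsBounded φ → IsBounded ψ → IsBounded (.imp φ ψ)
  | ballLt (x : ℕ) (t : L2Term) {φ : L2Formula} : ¬ t.HasVar x → IsBounded φ →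
      IsBounded (.all x (.imp (.lt (.var x) t) φ))
  | bexLt (x : ℕ) (t : L2Term) {φ : L2Formula} : ¬ t.HasVar x → IsBounded φ →
      IsBounded (.ex x (.and (.lt (.var x) t) φ))

def L2Formula.IsSigma01 (φ : L2Formula) : Prop :=
  ∃ (x : ℕ) (θ : L2Formula), θ.IsBounded ∧ φ = .ex x θ

def L2Formula.IsPi01 (φ : L2Formula) : Prop :=
  ∃ (x : ℕ) (θ : L2Formula), θ.IsBounded ∧ φ = .all x θ

/-- Formulas without set quantifiers (set parameters are allowed). -/
def L2Formula.IsArithmetical : L2Formula → Prop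
  | .eq _ _ => True
  | .lt _ _ => True
  | .mem _ _ => True
  | .not φ => φ.IsArithmetical
  | .and φ ψ => φ.IsArithmetical ∧ ψ.IsArithmetical
  | .or φ ψ => φ.IsArithmetical ∧ ψ.IsArithmetical
  | .imp φ ψ => φ.IsArithmetical ∧ ψ.IsArithmetical
  | .all _ φ => φ.IsArithmetical
  | .ex _ φ => φ.IsArithmetical
  | .allSet _ _ => False
  | .exSet _ _ => False

/-! ### The systems `RCA₀`, `WKL₀`, `ACA₀` -/

namespace L2Structure

variable (M : L2Structure)

def succ (n : M.N) : M.N := M.add n M.one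

structure BasicAxioms : Prop where
  succ_ne_zero : ∀ n, M.succ n ≠ M.zero
  succ_inj : ∀ m n, M.succ m = M.succ n → m = n
  add_zero : ∀ m, M.add m M.zero = m
  add_succ : ∀ m n, M.add m (M.succ n) = M.succ (M.add m n)
  mul_zero : ∀ m, M.mul m M.zero = M.zero
  mul_succ : ∀ m n, M.mul m (M.succ n) = M.add (M.mul m n) m
  not_lt_zero : ∀ m, ¬ M.lt m M.zero
  lt_succ : ∀ m n, M.lt m (M.succ n) ↔ M.lt m n ∨ m = n

/-- Induction for all `Σ⁰₁` formulas `φ(x)`, with number and set parameters. -/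
def Sigma01Induction : Prop :=
  ∀ φ : L2Formula, φ.IsSigma01 → ∀ (x : ℕ) (v : ℕ → M.N) (V : ℕ → Set M.N),
    (∀ i, V i ∈ M.sets) →
    φ.Sat M (Function.update v x M.zero) V →
    (∀ n, φ.Sat M (Function.update v x n) V → φ.Sat M (Function.update v x (M.succ n)) V) →
    ∀ n, φ.Sat M (Function.update v x n) V

/-- Comprehension for `Δ⁰₁` predicates, with number and set parameters. -/
def Delta01Comprehension : Prop :=
  ∀ φ ψ : L2Formula, φ.IsSigma01 → ψ.IsPi01 → ∀ (x : ℕ) (v : ℕ → M.N) (V : ℕ → Set M.N),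
    (∀ i, V i ∈ M.sets) →
    (∀ n, φ.Sat M (Function.update v x n) V ↔ ψ.Sat M (Function.update v x n) V) →
    ∃ A ∈ M.sets, ∀ n, n ∈ A ↔ φ.Sat M (Function.update v x n) V

/-- Comprehension for arithmetical formulas, with number and set parameters. -/
def ArithmeticalComprehension : Prop :=
  ∀ φ : L2Formula, φ.IsArithmetical → ∀ (x : ℕ) (v : ℕ → M.N) (V : ℕ → Set M.N),
    (∀ i, V i ∈ M.sets) →
    ∃ A ∈ M.sets, ∀ n, n ∈ A ↔ φ.Sat M (Function.update v x n) V

structure RCA0 : Prop where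
  basic : M.BasicAxioms
  induction : M.Sigma01Induction
  comprehension : M.Delta01Comprehension

structure ACA0 : Prop where
  rca0 : M.RCA0
  comprehension : M.ArithmeticalComprehension

/-- Finite binary strings are coded (bijectively, in `ω`) by numbers: `0` codes the empty string,
and if `σ` codes a string then `2σ+1` and `2σ+2` code its extensions by the bit `0` and the
bit `1`. -/
def child0 (σ : M.N) : M.N := M.succ (M.add σ σ)

def child1 (σ : M.N) : M.N := M.succ (M.succ (M.add σ σ))

/-- A set of (codes of) binary strings closed under initial segments. -/
def IsBinaryTree (T : Set M.N) : Prop :=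
  ∀ σ, (M.child0 σ ∈ T → σ ∈ T) ∧ (M.child1 σ ∈ T → σ ∈ T)

/-- `P` is the set of all initial segments of an infinite binary sequence. -/
def IsBinaryPath (P : Set M.N) : Prop :=
  M.IsBinaryTree P ∧ M.zero ∈ P ∧
    ∀ σ ∈ P, (M.child0 σ ∈ P ∧ M.child1 σ ∉ P) ∨ (M.child0 σ ∉ P ∧ M.child1 σ ∈ P)

/-- Weak König's lemma: every infinite binary tree has an infinite path. -/
def WeakKoenig : Prop :=
  ∀ T ∈ M.sets, M.IsBinaryTree T → (∀ m, ∃ σ ∈ T, M.lt m σ) →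
    ∃ P ∈ M.sets, M.IsBinaryPath P ∧ P ⊆ T

structure WKL0 : Prop where
  rca0 : M.RCA0
  weakKoenig : M.WeakKoenig

end L2Structure

/-- The `ω`-model with second-order part `I`. -/
def omegaModel (I : Set (Set ℕ)) (hI : I.Nonempty) : L2Structure where
  N := ℕ
  zero := 0
  one := 1
  add := (· + ·)
  mul := (· * ·)
  lt := (· < ·)
  sets := I
  sets_nonempty := hI

/-! ### Weak Martin's pointed tree theorem in `ω`-models -/

/-- The real `x : ω → ω`, represented by its graph, belongs to the `ω`-model with second-order
part `I`. -/
def RealMem (I : Set (Set ℕ)) (x : ℕ → ℕ) : Prop :=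
  {k | ∃ n, k = Nat.pair n (x n)} ∈ I

/-- The set `T` of finite strings, represented by its set of codes, belongs to the `ω`-model with
second-order part `I`. -/
def StringSetMem (I : Set (Set ℕ)) (T : Set (List ℕ)) : Prop :=
  Encodable.encode '' T ∈ I

/-- A subset of `ω^{<ω}` closed under initial segments. -/
def IsTree (T : Set (List ℕ)) : Prop :=
  ∀ σ τ : List ℕ, σ <+: τ → τ ∈ T → σ ∈ T

/-- `x ∈ [T]`. -/
def IsPath (T : Set (List ℕ)) (x : ℕ → ℕ) : Prop :=
  ∀ n : ℕ, (List.range n).map x ∈ T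

/-- A nonempty tree in which every node has two incompatible extensions. -/
def IsPerfectTree (S : Set (List ℕ)) : Prop :=
  IsTree S ∧ S.Nonempty ∧
    ∀ σ ∈ S, ∃ τ₀ ∈ S, ∃ τ₁ ∈ S, σ <+: τ₀ ∧ σ <+: τ₁ ∧ ¬ τ₀ <+: τ₁ ∧ ¬ τ₁ <+: τ₀

/-- Turing reducibility between reals in `ω^ω`. -/
def RealReducible (x y : ℕ → ℕ) : Prop :=
  (x : ℕ →. ℕ) ≤ᵀ (y : ℕ →. ℕ)

/-- `[T]` is cofinal in the `ω`-model with second-order part `I`. -/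
def IsCofinalIn (I : Set (Set ℕ)) (T : Set (List ℕ)) : Prop :=
  ∀ z : ℕ → ℕ, RealMem I z → ∃ x : ℕ → ℕ, RealMem I x ∧ IsPath T x ∧ RealReducible z x

/-- The `ω`-model with second-order part `I` satisfies weak Martin's pointed tree theorem: if
`T ⊆ ω^{<ω}` is a tree and `[T]` is cofinal, then `T` has a perfect subtree. -/
def OmegaWMPT (I : Set (Set ℕ)) : Prop :=
  ∀ T : Set (List ℕ), StringSetMem I T → IsTree T → IsCofinalIn I T →
    ∃ S : Set (List ℕ), StringSetMem I S ∧ S ⊆ T ∧ IsPerfectTree S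

/-! ### The relation `≫`, hyperimmune-free reals, and the model generated by a sequence -/

/-- Codes of oracle Turing functionals: `Nat.Partrec.Code` with one more base code, for the oracle. -/
inductive OracleCode : Type
  | zero
  | succ
  | left
  | right
  | oracle
  | pair (c d : OracleCode)
  | comp (c d : OracleCode)
  | prec (c d : OracleCode)
  | rfind' (c : OracleCode)

namespace OracleCode

/-- The partial function computed by a code with oracle `y`. -/
def eval (y : ℕ → ℕ) : OracleCode → ℕ →. ℕ
  | zero => pure 0
  | succ => Nat.succ
  | left => ↑fun n : ℕ => n.unpair.1
  | right => ↑fun n : ℕ => n.unpair.2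
  | oracle => y
  | pair c d => fun n => Nat.pair <$> eval y c n <*> eval y d n
  | comp c d => fun n => eval y d n >>= eval y c
  | prec c d =>
    Nat.unpaired fun a n =>
      n.rec (eval y c a) fun k IH => do
        let i ← IH
        eval y d (Nat.pair a (Nat.pair k i))
  | rfind' c =>
    Nat.unpaired fun a m =>
      (Nat.rfind fun n => (fun b => b = 0) <$> eval y c (Nat.pair a (n + m))).map (· + m)

/-- The `e`-th code, in a bijective numbering of all codes. -/
def ofNat : ℕ → OracleCode
  | 0 => zero
  | 1 => succ
  | 2 => left
  | 3 => right
  | 4 => oracle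
  | n + 5 =>
    let m := n.div2.div2
    have hm : m < n + 5 := by
      simp only [m, Nat.div2_val]
      omega
    have _m1 : m.unpair.1 < n + 5 := lt_of_le_of_lt m.unpair_left_le hm
    have _m2 : m.unpair.2 < n + 5 := lt_of_le_of_lt m.unpair_right_le hm
    match n.bodd, n.div2.bodd with
    | false, false => pair (ofNat m.unpair.1) (ofNat m.unpair.2)
    | false, true => comp (ofNat m.unpair.1) (ofNat m.unpair.2)
    | true, false => prec (ofNat m.unpair.1) (ofNat m.unpair.2)
    | true, true => rfind' (ofNat m)
  decreasing_by all_goals assumption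

end OracleCode

/-- `Φ_e^y`, the `e`-th partial function recursive in `y`. -/
def turingFunctional (e : ℕ) (y : ℕ → ℕ) : ℕ →. ℕ :=
  (OracleCode.ofNat e).eval y

/-- `x ≫ y`: there is `z ≤_T x` in `2^ω` with `z(e) ≠ Φ_e^y(e)` for all `e` (in particular the
condition on `e` holds where `Φ_e^y(e)` is undefined). -/
def PADominates (x y : ℕ → ℕ) : Prop :=
  ∃ z : ℕ → ℕ, RealReducible z x ∧ (∀ e, z e < 2) ∧ ∀ e, z e ∉ turingFunctional e y e

/-- Every `x`-recursive function is dominated by a recursive function. -/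
def HyperimmuneFree (x : ℕ → ℕ) : Prop :=
  ∀ f : ℕ → ℕ, RealReducible f x →
    ∃ g : ℕ → ℕ, Computable g ∧ ∀ᶠ n in Filter.atTop, f n ≤ g n

open scoped Classical in
/-- All sets of numbers that are Turing reducible to some `x n`. -/
noncomputable def generatedBy (x : ℕ → ℕ → ℕ) : Set (Set ℕ) :=
  {A | ∃ n, RealReducible (fun k => if k ∈ A then 1 else 0) (x n)}

theorem generatedBy_nonempty (x : ℕ → ℕ → ℕ) : (generatedBy x).Nonempty := by
  refine ⟨∅, 0, ?_⟩
  have h : Computable (fun _ : ℕ => (0 : ℕ)) := Computable.const 0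
  simpa [RealReducible] using (h.partrec.turingReducible (g := (x 0 : ℕ →. ℕ)))

/-! ### Relative computability -/

section RelativeComputability

open Encodable Part

variable {α β γ σ : Type*} [Primcodable α] [Primcodable β] [Primcodable γ] [Primcodable σ]
variable {O : Set (ℕ →. ℕ)}

/-! The chain is built by iterating one fact. The 0-1-valued functions that avoid the diagonal of
`y` form a nonempty Π⁰₁(y) class, and if `y` is hyperimmune-free this class has a hyperimmune-free
member (`HyperimmuneFree.exists_avoidsDiagonal`): forcing with Π⁰₁(y) subclasses and compactness of
Cantor space gives `y`-recursive bounds, and these have recursive bounds in turn. A function `z`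
avoiding the diagonal of `y` can pick a true statement from a finite list of Π⁰₁(y) statements that
are not all false (`AvoidsDiagonal.exists_choice`). Hence `z` computes `y`, so the chain is
increasing and generates a model of `RCA₀`, and `z` computes paths through infinite binary trees
recursive in `y`, which gives weak König's lemma. Arithmetical comprehension fails because the
halting problem computes a function that no recursive function dominates.

For the pointed tree theorem, let `T` be recursive in `y = x n` with cofinal paths, and let `z` in
the model avoid the diagonal of `y`. Cofinality gives a path `w` of `T` in the model that computes
`z`. As `w` lies below a hyperimmune-free real, `w` has a recursive bound `g`, and the use of the
computation of `z` from `w` has a recursive bound `u`. So `T` may be cut down to a finitely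
branching tree on whose strings the functional Ψ computing `z` can be evaluated up to a known
length.

The core is a self-referential pruning. The recursion theorem assigns to each string `σ` an index `θ
σ`, and a string is discarded as soon as some initial segment `σ` of it is seen not to have
extensions giving both values 0 and 1 under Ψ at argument `θ σ`. The program `θ σ` waits for this
failure and then outputs a value still attained above `σ`, if there is one. If `σ` is on `w`, then
`w` gives the value `z (θ σ)`, which differs from that output because `z` avoids the diagonal; so
both values are attained, or the output was wrongly chosen, a contradiction. Thus `w` is never
pruned (`initialSegment_mem_prune_level`). By compactness every string that survives has two
surviving extensions with different Ψ-values (`Survives.exists_extension`). Survival is a Π⁰₁(y)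
property, so `z` can choose such extensions and build a perfect subtree
(`exists_isPerfectTree_of_path`). -/

theorem ComputableIn.of_eq {f g : α → σ} (hf : ComputableIn O f) (H : ∀ a, f a = g a) :
    ComputableIn O g :=
  (funext H : f = g) ▸ hf

theorem RecursiveIn.comp {f : β →. σ} {g : α → β} (hf : RecursiveIn O f)
    (hg : ComputableIn O g) : RecursiveIn O fun a => f (g a) :=
  (Nat.RecursiveIn.comp hf hg).of_eq fun n => by
    rcases e : decode (α := α) n with - | a <;> simp [encodek]

theorem ComputableIn.comp {f : β → σ} {g : α → β} (hf : ComputableIn O f)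
    (hg : ComputableIn O g) : ComputableIn O fun a => f (g a) :=
  RecursiveIn.comp (f := fun b => Part.some (f b)) hf hg

theorem ComputableIn.pair {f : α → β} {g : α → γ} (hf : ComputableIn O f)
    (hg : ComputableIn O g) : ComputableIn O fun a => (f a, g a) :=
  (Nat.RecursiveIn.pair hf hg).of_eq fun n => by
    rcases e : decode (α := α) n <;> simp [Seq.seq]

protected theorem RecursiveIn.bind {f : α →. β} {g : α → β →. σ} (hf : RecursiveIn O f)
    (hg : RecursiveIn₂ O g) : RecursiveIn O fun a => (f a).bind (g a) :=
  (Nat.RecursiveIn.comp hg (Nat.RecursiveIn.pair (Partrec.nat_iff.1 Partrec.some).recursiveIn hf)).of_eq fun n => by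
    rcases e : decode (α := α) n with - | a
    · simp [Seq.seq]
    · simp only [Seq.seq]
      simp [e, encodek]
      exact (Part.map_bind (g a) (f a) _).symm

theorem RecursiveIn.map {f : α →. β} {g : α → β → σ} (hf : RecursiveIn O f)
    (hg : ComputableIn₂ O g) : RecursiveIn O fun a => (f a).map (g a) := by
  simpa [bind_some_eq_map] using RecursiveIn.bind (g := fun a x => Part.some (g a x)) hf hg

theorem RecursiveIn.rfind {p : α → ℕ → Bool} (hp : ComputableIn₂ O p) :
    RecursiveIn O fun a => Nat.rfind (p a : ℕ →. Bool) :=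
  (Nat.RecursiveIn.rfind <|
    RecursiveIn.map (f := fun q : α × ℕ => Part.some (p q.1 q.2)) (g := fun _ b => cond b 0 1) hp
      (((Primrec.dom_bool fun b => cond b 0 1).comp Primrec.snd).computableIn :
        ComputableIn O fun q : (α × ℕ) × Bool => cond q.2 0 1)).of_eq fun n => by
    rcases e : decode (α := α) n with - | a
    · simpa [e] using Nat.rfind_zero_none (fun _ => Part.none) rfl
    · simp [e]
      refine Eq.trans ?_ (Part.map_id' (fun _ => rfl) _).symm
      congr 1
      funext k
      change Part.some _ = Part.some _
      cases p a k <;> rfl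

theorem RecursiveIn.nat_rec {f : α → ℕ} {g : α →. σ} {h : α → ℕ × σ →. σ}
    (hf : ComputableIn O f) (hg : RecursiveIn O g) (hh : RecursiveIn₂ O h) :
    RecursiveIn O fun a =>
      Nat.rec (motive := fun _ => Part σ) (g a) (fun y IH => IH.bind fun i => h a (y, i)) (f a) :=
  (Nat.RecursiveIn.comp (Nat.RecursiveIn.prec hg hh)
    (Nat.RecursiveIn.pair (Partrec.nat_iff.1 Partrec.some).recursiveIn hf)).of_eq fun n => by
    rcases e : decode (α := α) n with - | a
    · simp [Seq.seq]
    · simp only [Seq.seq]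
      simp
      induction f a <;> simp_all

theorem ComputableIn.nat_rec {f : α → ℕ} {g : α → σ} {h : α → ℕ → σ → σ}
    (hf : ComputableIn O f) (hg : ComputableIn O g)
    (hh : ComputableIn O fun p : α × ℕ × σ => h p.1 p.2.1 p.2.2) :
    ComputableIn O fun a => Nat.rec (motive := fun _ => σ) (g a) (h a) (f a) :=
  RecursiveIn.of_eq (RecursiveIn.nat_rec (g := fun a => Part.some (g a))
    (h := fun a p => Part.some (h a p.1 p.2)) hf hg hh) fun a => by
    change _ = Part.some (Nat.rec (motive := fun _ => σ) (g a) (h a) (f a))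
    generalize f a = n
    induction n with
    | zero => rfl
    | succ n ih => simp only [ih, bind_some]

theorem ComputableIn.nat_casesOn {f : α → ℕ} {g : α → σ} {h : α → ℕ → σ}
    (hf : ComputableIn O f) (hg : ComputableIn O g)
    (hh : ComputableIn O fun p : α × ℕ => h p.1 p.2) :
    ComputableIn O fun a => Nat.casesOn (motive := fun _ => σ) (f a) (g a) (h a) :=
  nat_rec (h := fun a n _ => h a n) hf hg
    (comp hh (ComputableIn.fst.pair (ComputableIn.fst.comp ComputableIn.snd)))

theorem ComputableIn.cond {c : α → Bool} {f g : α → σ} (hc : ComputableIn O c)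
    (hf : ComputableIn O f) (hg : ComputableIn O g) :
    ComputableIn O fun a => cond (c a) (f a) (g a) :=
  (nat_casesOn (h := fun a _ => f a) (Computable.encode.computableIn.comp hc) hg
    (hf.comp ComputableIn.fst)).of_eq fun a => by
    cases c a <;> rfl

theorem RecursiveIn.ofOption {f : α → Option β} (hf : ComputableIn O f) :
    RecursiveIn O fun a => (f a : Part β) :=
  RecursiveIn.comp (f := fun o : Option β => (o : Part β))
    (Computable.ofOption Computable.id).recursiveIn hf

theorem ComputableIn.list_foldl {f : α → List β} {g : α → σ} {h : α → σ → β → σ}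
    (hf : ComputableIn O f) (hg : ComputableIn O g)
    (hh : ComputableIn O fun p : α × σ × β => h p.1 p.2.1 p.2.2) :
    ComputableIn O fun a => (f a).foldl (h a) (g a) := by
  have hget : ComputableIn O fun p : α × ℕ × σ => (f p.1)[p.2.1]? :=
    Computable.list_getElem?.computableIn.comp
      ((hf.comp ComputableIn.fst).pair (ComputableIn.fst.comp ComputableIn.snd))
  -- The type `β` may be empty, so there is no default entry for an index out of range; the
  -- recursion on the index is run with partial values and shown to be total afterwards.
  have hstep : RecursiveIn O fun p : α × ℕ × σ =>
      ((f p.1)[p.2.1]? : Part β).bind fun b => Part.some (h p.1 p.2.2 b) :=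
    RecursiveIn.bind (g := fun (p : α × ℕ × σ) b => Part.some (h p.1 p.2.2 b)) (RecursiveIn.ofOption hget)
      (ComputableIn.comp hh ((ComputableIn.fst.comp ComputableIn.fst).pair
        (((ComputableIn.snd.comp ComputableIn.snd).comp ComputableIn.fst).pair
          ComputableIn.snd)))
  refine RecursiveIn.of_eq (RecursiveIn.nat_rec
    (h := fun a p => ((f a)[p.1]? : Part β).bind fun b => Part.some (h a p.2 b))
    (Computable.list_length.computableIn.comp hf) hg hstep) fun a => ?_
  have : ∀ n ≤ (f a).length, Nat.rec (motive := fun _ => Part σ) (Part.some (g a))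
      (fun y IH => IH.bind fun i =>
        ((f a)[(y, i).1]? : Part β).bind fun b => Part.some (h a (y, i).2 b)) n =
      Part.some (((f a).take n).foldl (h a) (g a)) := by
    intro n hn
    induction n with
    | zero => simp
    | succ n ih =>
      have hlt : n < (f a).length := hn
      simp only [ih hlt.le, bind_some]
      rw [List.take_add_one, List.foldl_append, List.getElem?_eq_getElem hlt]
      simp
  simpa using this _ le_rfl

theorem ComputableIn.list_map {f : α → List β} {h : α → β → σ} (hf : ComputableIn O f)
    (hh : ComputableIn O fun p : α × β => h p.1 p.2) :
    ComputableIn O fun a => (f a).map (h a) :=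
  (list_foldl (h := fun a l b => l ++ [h a b]) hf (.const [])
    (Computable.list_concat.computableIn.comp ((ComputableIn.fst.comp ComputableIn.snd).pair
      (hh.comp (ComputableIn.fst.pair (ComputableIn.snd.comp ComputableIn.snd)))))).of_eq
    fun a => by
      have : ∀ (l : List β) (m : List σ), l.foldl (fun l b => l ++ [h a b]) m = m ++ l.map (h a) := by
        intro l
        induction l with
        | nil => simp
        | cons b l ih => intro m; simp [ih]
      simp [this]

theorem ComputableIn.list_flatMap {f : α → List β} {h : α → β → List σ} (hf : ComputableIn O f)
    (hh : ComputableIn O fun p : α × β => h p.1 p.2) :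
    ComputableIn O fun a => (f a).flatMap (h a) :=
  (Primrec.list_flatten.computableIn.comp (list_map hf hh)).of_eq fun _ =>
    List.flatMap_def.symm

theorem ComputableIn.option_casesOn {o : α → Option β} {f : α → σ} {g : α → β → σ}
    (ho : ComputableIn O o) (hf : ComputableIn O f)
    (hg : ComputableIn O fun p : α × β => g p.1 p.2) :
    ComputableIn O fun a => Option.casesOn (motive := fun _ => σ) (o a) (f a) (g a) :=
  (list_foldl (h := fun a _ b => g a b)
    ((Computable.option_casesOn (g := fun (_ : Option β) b => [b]) Computable.id (.const [])
      (Computable.list_cons.comp Computable.snd (.const []) :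
        Computable fun p : Option β × β => [p.2])).computableIn.comp ho) hf
    (hg.comp (ComputableIn.fst.pair (ComputableIn.snd.comp ComputableIn.snd)))).of_eq
    fun a => by cases o a <;> simp

theorem ComputableIn.option_getD {f : α → Option β} {g : α → β} (hf : ComputableIn O f)
    (hg : ComputableIn O g) : ComputableIn O fun a => (f a).getD (g a) :=
  (option_casesOn hf hg ComputableIn.snd).of_eq fun a => by cases f a <;> rfl

/-- The predicate `P` is decidable by an algorithm with oracles `O`. -/
def DecidableIn (O : Set (ℕ →. ℕ)) (P : α → Prop) : Prop :=
  ∃ f : α → Bool, ComputableIn O f ∧ ∀ a, f a = true ↔ P a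

namespace DecidableIn

variable {P Q : α → Prop}

theorem of_iff (hP : DecidableIn O P) (H : ∀ a, P a ↔ Q a) : DecidableIn O Q :=
  let ⟨f, hf, h⟩ := hP
  ⟨f, hf, fun a => (h a).trans (H a)⟩

theorem decide [DecidablePred P] (hP : DecidableIn O P) :
    ComputableIn O fun a => decide (P a) :=
  let ⟨_, hf, h⟩ := hP
  hf.of_eq fun a => by rw [Bool.eq_iff_iff, h, decide_eq_true_iff]

theorem of_computableIn {f : α → Bool} (hf : ComputableIn O f) :
    DecidableIn O fun a => f a = true :=
  ⟨f, hf, fun _ => Iff.rfl⟩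

theorem of_primrecPred (hP : PrimrecPred P) : DecidableIn O P :=
  let ⟨_, h⟩ := hP
  ⟨_, h.computableIn, fun _ => decide_eq_true_iff⟩

theorem comp {P : β → Prop} {f : α → β} (hP : DecidableIn O P) (hf : ComputableIn O f) :
    DecidableIn O fun a => P (f a) :=
  let ⟨g, hg, h⟩ := hP
  ⟨fun a => g (f a), hg.comp hf, fun a => h (f a)⟩

theorem not (hP : DecidableIn O P) : DecidableIn O fun a => ¬ P a :=
  let ⟨f, hf, h⟩ := hP
  ⟨fun a => !f a, Primrec.not.computableIn.comp hf, fun a => by simp [← h]⟩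

theorem and (hP : DecidableIn O P) (hQ : DecidableIn O Q) : DecidableIn O fun a => P a ∧ Q a :=
  let ⟨f, hf, h⟩ := hP
  let ⟨g, hg, k⟩ := hQ
  ⟨fun a => f a && g a, Primrec.and.computableIn.comp (hf.pair hg), fun a => by simp [← h, ← k]⟩

theorem or (hP : DecidableIn O P) (hQ : DecidableIn O Q) : DecidableIn O fun a => P a ∨ Q a :=
  let ⟨f, hf, h⟩ := hP
  let ⟨g, hg, k⟩ := hQ
  ⟨fun a => f a || g a, Primrec.or.computableIn.comp (hf.pair hg), fun a => by simp [← h, ← k]⟩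

theorem imp (hP : DecidableIn O P) (hQ : DecidableIn O Q) : DecidableIn O fun a => P a → Q a :=
  (hP.not.or hQ).of_iff fun _ => imp_iff_not_or.symm

theorem ite [DecidablePred P] {f g : α → σ} (hP : DecidableIn O P) (hf : ComputableIn O f)
    (hg : ComputableIn O g) : ComputableIn O fun a => if P a then f a else g a :=
  (hP.decide.cond hf hg).of_eq fun a => by by_cases h : P a <;> simp [h]

theorem eq {f g : α → β} (hf : ComputableIn O f) (hg : ComputableIn O g) :
    DecidableIn O fun a => f a = g a := by
  classical exact (of_primrecPred (O := O) (Primrec.eq (α := β))).comp (hf.pair hg)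

theorem le {f g : α → ℕ} (hf : ComputableIn O f) (hg : ComputableIn O g) :
    DecidableIn O fun a => f a ≤ g a :=
  (of_primrecPred (O := O) Primrec.nat_le).comp (hf.pair hg)

theorem lt {f g : α → ℕ} (hf : ComputableIn O f) (hg : ComputableIn O g) :
    DecidableIn O fun a => f a < g a :=
  (of_primrecPred (O := O) Primrec.nat_lt).comp (hf.pair hg)

theorem exists_mem {f : α → List β} {P : α → β → Prop} (hf : ComputableIn O f)
    (hP : DecidableIn O fun p : α × β => P p.1 p.2) : DecidableIn O fun a => ∃ b ∈ f a, P a b := by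
  obtain ⟨g, hg, h⟩ := hP
  refine ⟨fun a => (f a).foldl (fun s b => s || g (a, b)) false,
    ComputableIn.list_foldl (h := fun a s b => s || g (a, b)) hf (.const false)
      (Primrec.or.computableIn.comp ((ComputableIn.fst.comp ComputableIn.snd).pair
        (hg.comp (ComputableIn.fst.pair (ComputableIn.snd.comp ComputableIn.snd))))), fun a => ?_⟩
  have : ∀ (l : List β) (s : Bool), l.foldl (fun s b => s || g (a, b)) s = true ↔
      s = true ∨ ∃ b ∈ l, P a b := by
    intro l
    induction l with
    | nil => simp
    | cons b l ih => intro s; simp [ih, h, or_assoc]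
  simp [this]

theorem forall_mem {f : α → List β} {P : α → β → Prop} (hf : ComputableIn O f)
    (hP : DecidableIn O fun p : α × β => P p.1 p.2) : DecidableIn O fun a => ∀ b ∈ f a, P a b :=
  (exists_mem (P := fun a b => ¬ P a b) hf hP.not).not.of_iff fun a => by push Not; rfl

theorem exists_lt {f : α → ℕ} {P : α → ℕ → Prop} (hf : ComputableIn O f)
    (hP : DecidableIn O fun p : α × ℕ => P p.1 p.2) : DecidableIn O fun a => ∃ n < f a, P a n :=
  (exists_mem (Primrec.list_range.computableIn.comp hf) hP).of_iff fun a => by simp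

theorem forall_lt {f : α → ℕ} {P : α → ℕ → Prop} (hf : ComputableIn O f)
    (hP : DecidableIn O fun p : α × ℕ => P p.1 p.2) : DecidableIn O fun a => ∀ n < f a, P a n :=
  (forall_mem (Primrec.list_range.computableIn.comp hf) hP).of_iff fun a => by simp

theorem list_filter {f : α → List β} {P : α → β → Prop} [∀ a, DecidablePred (P a)]
    (hf : ComputableIn O f) (hP : DecidableIn O fun p : α × β => P p.1 p.2) :
    ComputableIn O fun a => (f a).filter fun b => Decidable.decide (P a b) :=
  (ComputableIn.list_flatMap (h := fun a b => if P a b then [b] else []) hf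
    (ite (P := fun p : α × β => P p.1 p.2) hP
      (Computable.list_cons.computableIn.comp (ComputableIn.snd.pair (.const []))) (.const []))).of_eq
    fun a => by
      induction f a with
      | nil => rfl
      | cons b l ih => by_cases h : P a b <;> simp [h, ih]

theorem rfind_map {P : α → ℕ → Prop} {g : α → ℕ → σ}
    (hP : DecidableIn O fun p : α × ℕ => P p.1 p.2)
    (hg : ComputableIn O fun p : α × ℕ => g p.1 p.2) :
    ∃ F : α →. σ, RecursiveIn O F ∧ ∀ a v, v ∈ F a ↔ ∃ s, P a s ∧ (∀ t < s, ¬ P a t) ∧ v = g a s := by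
  obtain ⟨f, hf, h⟩ := hP
  refine ⟨fun a => (Nat.rfind ((fun n => f (a, n) : ℕ → Bool) : ℕ →. Bool)).map (g a),
    RecursiveIn.map (RecursiveIn.rfind (p := fun a n => f (a, n)) hf) hg, fun a v => ?_⟩
  simp only [Part.mem_map_iff, Nat.mem_rfind, PFun.coe_val, Part.mem_some_iff]
  refine exists_congr fun s => ?_
  simp only [← h (a, _), eq_comm (a := true), eq_comm (a := false), Bool.not_eq_true, and_assoc,
    eq_comm (a := v)]

theorem find {P : α → ℕ → Prop} (hP : DecidableIn O fun p : α × ℕ => P p.1 p.2)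
    (H : ∀ a, ∃ n, P a n) :
    ∃ f : α → ℕ, ComputableIn O f ∧ ∀ a, P a (f a) ∧ ∀ m < f a, ¬ P a m := by
  classical
  obtain ⟨F, hF, h⟩ := rfind_map (g := fun _ n => n) hP ComputableIn.snd
  refine ⟨fun a => Nat.find (H a), hF.of_eq_tot fun a => (h a _).2
    ⟨_, Nat.find_spec (H a), fun t ht => Nat.find_min (H a) ht, rfl⟩, fun a =>
    ⟨Nat.find_spec (H a), fun t ht => Nat.find_min (H a) ht⟩⟩

end DecidableIn

end RelativeComputability

/-! ### Oracle codes -/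

namespace OracleCode

/-- The code `c` with an oracle that is a partial function with graph `o` outputs `v` at `n`. -/
def Computes (o : ℕ → ℕ → Prop) : OracleCode → ℕ → ℕ → Prop
  | zero => fun _ v => v = 0
  | succ => fun n v => v = n + 1
  | left => fun n v => v = n.unpair.1
  | right => fun n v => v = n.unpair.2
  | oracle => o
  | pair c d => fun n v => ∃ a, Computes o c n a ∧ ∃ b, Computes o d n b ∧ Nat.pair a b = v
  | comp c d => fun n v => ∃ a, Computes o d n a ∧ Computes o c a v
  | prec c d => fun n =>
    Nat.rec (motive := fun _ => ℕ → Prop) (Computes o c n.unpair.1)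
      (fun k IH v => ∃ i, IH i ∧ Computes o d (Nat.pair n.unpair.1 (Nat.pair k i)) v) n.unpair.2
  | rfind' c => fun n v => ∃ k, (Computes o c (Nat.pair n.unpair.1 (k + n.unpair.2)) 0 ∧
      ∀ m < k, ∃ b, Computes o c (Nat.pair n.unpair.1 (m + n.unpair.2)) b ∧ b ≠ 0) ∧
        k + n.unpair.2 = v

theorem mem_rfind_map {f : ℕ → Part ℕ} {k : ℕ} :
    k ∈ Nat.rfind (fun n => (f n).map fun b => decide (b = 0)) ↔
      0 ∈ f k ∧ ∀ m < k, ∃ b, b ∈ f m ∧ b ≠ 0 := by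
  refine Nat.mem_rfind.trans (and_congr ?_ (forall_congr' fun m => ?_))
  · refine (Part.mem_map_iff _).trans ?_
    simp
  · refine imp_congr_right fun _ => (Part.mem_map_iff _).trans ?_
    simp

theorem mem_seq_pair {f g : Part ℕ} {v : ℕ} :
    v ∈ Nat.pair <$> f <*> g ↔ ∃ a, a ∈ f ∧ ∃ b, b ∈ g ∧ Nat.pair a b = v := by
  simp [Seq.seq]

theorem mem_eval (y : ℕ → ℕ) (c : OracleCode) (n v : ℕ) :
    v ∈ eval y c n ↔ Computes (fun n v => v = y n) c n v := by
  induction c generalizing n v with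
  | zero | succ | left | right | oracle => exact Part.mem_some_iff
  | pair c d hc hd =>
    simp only [Computes, ← hc, ← hd]
    exact mem_seq_pair
  | comp c d hc hd =>
    simp only [Computes, ← hc, ← hd]
    exact Part.mem_bind_iff
  | prec c d hc hd =>
    simp only [Computes, eval, Nat.unpaired]
    induction n.unpair.2 generalizing v with
    | zero => exact hc _ _
    | succ k ih =>
      exact Part.mem_bind_iff.trans (exists_congr fun i => and_congr (ih i) (hd _ _))
  | rfind' c hc =>
    simp only [Computes, ← hc]
    refine (Part.mem_map_iff _).trans (exists_congr fun k => and_congr_left fun _ => ?_)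
    exact mem_rfind_map

theorem Computes.mono {o o' : ℕ → ℕ → Prop} (h : ∀ n v, o n v → o' n v) {c : OracleCode} :
    ∀ {n v}, Computes o c n v → Computes o' c n v := by
  induction c with
  | zero | succ | left | right => exact id
  | oracle => exact h _ _
  | pair c d hc hd =>
    rintro n v ⟨a, ha, b, hb, rfl⟩
    exact ⟨a, hc ha, b, hd hb, rfl⟩
  | comp c d hc hd =>
    rintro n v ⟨a, ha, hv⟩
    exact ⟨a, hd ha, hc hv⟩
  | prec c d hc hd =>
    intro n
    simp only [Computes]
    induction n.unpair.2 with
    | zero => exact hc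
    | succ k ih =>
      rintro v ⟨i, hi, hv⟩
      exact ⟨i, ih hi, hd hv⟩
  | rfind' c hc =>
    rintro n v ⟨k, ⟨h0, hlt⟩, rfl⟩
    exact ⟨k, ⟨hc h0, fun m hm => (hlt m hm).imp fun b hb => ⟨hc hb.1, hb.2⟩⟩, rfl⟩

theorem exists_ofNat (c : OracleCode) : ∃ e, ofNat e = c := by
  induction c with
  | zero => exact ⟨0, by simp [ofNat]⟩
  | succ => exact ⟨1, by simp [ofNat]⟩
  | left => exact ⟨2, by simp [ofNat]⟩
  | right => exact ⟨3, by simp [ofNat]⟩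
  | oracle => exact ⟨4, by simp [ofNat]⟩
  | pair c d hc hd =>
    obtain ⟨a, rfl⟩ := hc
    obtain ⟨b, rfl⟩ := hd
    -- Five indices are taken by the base codes; after subtracting 5, the two lowest bits select the
    -- constructor and the remaining bits hold the indices of the arguments.
    exact ⟨2 * (2 * Nat.pair a b) + 5, by simp [ofNat, Nat.div2_val]⟩
  | comp c d hc hd =>
    obtain ⟨a, rfl⟩ := hc
    obtain ⟨b, rfl⟩ := hd
    exact ⟨2 * (2 * Nat.pair a b + 1) + 5, by simp [ofNat, Nat.div2_val]⟩
  | prec c d hc hd =>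
    obtain ⟨a, rfl⟩ := hc
    obtain ⟨b, rfl⟩ := hd
    exact ⟨2 * (2 * Nat.pair a b) + 1 + 5, by simp [ofNat, Nat.div2_val]⟩
  | rfind' c hc =>
    obtain ⟨a, rfl⟩ := hc
    exact ⟨2 * (2 * a + 1) + 1 + 5, by simp [ofNat, Nat.div2_val]⟩

theorem exists_eval_eq {y : ℕ → ℕ} {f : ℕ →. ℕ} (hf : Nat.RecursiveIn {(y : ℕ →. ℕ)} f) :
    ∃ c : OracleCode, c.eval y = f := by
  induction hf with
  | zero => exact ⟨zero, rfl⟩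
  | succ => exact ⟨succ, rfl⟩
  | left => exact ⟨left, rfl⟩
  | right => exact ⟨right, rfl⟩
  | oracle g hg => exact ⟨oracle, (Set.mem_singleton_iff.1 hg).symm⟩
  | pair _ _ hf hg =>
    obtain ⟨c, rfl⟩ := hf
    obtain ⟨d, rfl⟩ := hg
    exact ⟨pair c d, rfl⟩
  | comp _ _ hf hg =>
    obtain ⟨c, rfl⟩ := hf
    obtain ⟨d, rfl⟩ := hg
    exact ⟨comp c d, rfl⟩
  | prec _ _ hf hg =>
    obtain ⟨c, rfl⟩ := hf
    obtain ⟨d, rfl⟩ := hg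
    exact ⟨prec c d, rfl⟩
  | rfind _ hf =>
    obtain ⟨c, rfl⟩ := hf
    -- Unbounded search is `rfind'` with its counter started at 0; `pair left right` is the
    -- identity.
    refine ⟨comp (rfind' c) (pair (pair left right) zero), funext fun n => Part.ext fun v => ?_⟩
    rw [mem_eval]
    have key : ∀ m w, Computes (fun n v => v = y n) c m w ↔ w ∈ eval y c m :=
      fun m w => (mem_eval y c m w).symm
    simp only [Computes, key]
    refine Iff.trans ?_ mem_rfind_map.symm
    simp

theorem exists_turingFunctional_eq {y : ℕ → ℕ} {f : ℕ →. ℕ} (hf : RecursiveIn {(y : ℕ →. ℕ)} f) :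
    ∃ e, turingFunctional e y = f := by
  obtain ⟨c, rfl⟩ := exists_eval_eq (RecursiveIn.iff_nat.1 hf)
  obtain ⟨e, rfl⟩ := c.exists_ofNat
  exact ⟨e, rfl⟩

/-- An index of the constant function with value `n`. -/
def constIndex (n : ℕ) : ℕ :=
  Nat.rec 0 (fun _ i => 2 * (2 * Nat.pair 1 i + 1) + 5) n

/-- An index of the constant function whose value is that of `Φ_n` at `a`. -/
def appIndex (n a : ℕ) : ℕ :=
  2 * (2 * Nat.pair n (constIndex a) + 1) + 5

theorem ofNat_comp (a b : ℕ) :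
    ofNat (2 * (2 * Nat.pair a b + 1) + 5) = comp (ofNat a) (ofNat b) := by
  simp [ofNat, Nat.div2_val]

theorem turingFunctional_constIndex (y : ℕ → ℕ) (n m : ℕ) :
    turingFunctional (constIndex n) y m = Part.some n := by
  refine Part.eq_some_iff.2 ((mem_eval ..).2 ?_)
  induction n with
  | zero =>
    change Computes _ (ofNat 0) m 0
    simp [ofNat, Computes]
  | succ n ih =>
    change Computes _ (ofNat (2 * (2 * Nat.pair 1 (constIndex n) + 1) + 5)) m _
    rw [ofNat_comp]
    exact ⟨n, ih, by simp [ofNat, Computes]⟩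

theorem turingFunctional_appIndex (y : ℕ → ℕ) (n a m : ℕ) :
    turingFunctional (appIndex n a) y m = turingFunctional n y a := by
  refine Part.ext fun v => ?_
  rw [turingFunctional, appIndex, ofNat_comp]
  refine Part.mem_bind_iff.trans ?_
  rw [← turingFunctional, turingFunctional_constIndex, ← turingFunctional]
  simp

theorem primrec_constIndex : Primrec constIndex :=
  Primrec.nat_rec₁ 0 (Primrec.nat_add.comp (Primrec.nat_mul.comp (.const 2) (Primrec.nat_add.comp
    (Primrec.nat_mul.comp (.const 2) (Primrec₂.natPair.comp (.const 1) .snd)) (.const 1)))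
    (.const 5))

theorem primrec_appIndex : Primrec fun p : ℕ × ℕ => appIndex p.1 p.2 :=
  Primrec.nat_add.comp (Primrec.nat_mul.comp (.const 2) (Primrec.nat_add.comp
    (Primrec.nat_mul.comp (.const 2) (Primrec₂.natPair.comp .fst
      (primrec_constIndex.comp .snd))) (.const 1))) (.const 5)

end OracleCode

/-- The initial segment of length `n` of a real. -/
def initialSegment (y : ℕ → ℕ) (n : ℕ) : List ℕ :=
  (List.range n).map y

namespace OracleCode

/-- The use principle: a halting computation asks finitely many oracle questions. It is stated for
all sufficiently long initial segments so that bounds for subcomputations combine by `max`. -/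
theorem Computes.exists_initialSegment {y : ℕ → ℕ} {c : OracleCode} :
    ∀ {n v}, Computes (fun n v => v = y n) c n v →
      ∃ s, ∀ t ≥ s, Computes (fun n v => v ∈ (initialSegment y t)[n]?) c n v := by
  induction c with
  | zero | succ | left | right => exact fun hv => ⟨0, fun _ _ => hv⟩
  | oracle =>
    intro n v hv
    refine ⟨n + 1, fun t ht => ?_⟩
    have : n < t := ht
    simp_all [Computes, initialSegment]
  | pair c d hc hd =>
    rintro n v ⟨a, ha, b, hb, rfl⟩
    obtain ⟨s, hs⟩ := hc ha
    obtain ⟨s', hs'⟩ := hd hb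
    exact ⟨max s s', fun t ht => ⟨a, hs t (le_of_max_le_left ht), b,
      hs' t (le_of_max_le_right ht), rfl⟩⟩
  | comp c d hc hd =>
    rintro n v ⟨a, ha, hv⟩
    obtain ⟨s, hs⟩ := hc hv
    obtain ⟨s', hs'⟩ := hd ha
    exact ⟨max s s', fun t ht => ⟨a, hs' t (le_of_max_le_right ht), hs t (le_of_max_le_left ht)⟩⟩
  | prec c d hc hd =>
    intro n
    simp only [Computes]
    induction n.unpair.2 with
    | zero => exact hc
    | succ k ih =>
      rintro v ⟨i, hi, hv⟩
      obtain ⟨s, hs⟩ := ih hi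
      obtain ⟨s', hs'⟩ := hd hv
      exact ⟨max s s', fun t ht => ⟨i, hs t (le_of_max_le_left ht), hs' t (le_of_max_le_right ht)⟩⟩
  | rfind' c hc =>
    rintro n v ⟨k, ⟨h0, hlt⟩, rfl⟩
    obtain ⟨s, hs⟩ := hc h0
    have : ∀ m < k, ∃ s, ∀ t ≥ s, ∃ b, Computes (fun n v => v ∈ (initialSegment y t)[n]?) c
        (Nat.pair n.unpair.1 (m + n.unpair.2)) b ∧ b ≠ 0 := by
      intro m hm
      obtain ⟨b, hb, hb'⟩ := hlt m hm
      obtain ⟨s, hs⟩ := hc hb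
      exact ⟨s, fun t ht => ⟨b, hs t ht, hb'⟩⟩
    choose! S hS using this
    refine ⟨max s ((Finset.range k).sup S), fun t ht =>
      ⟨k, ⟨hs t (le_of_max_le_left ht), fun m hm => hS m hm t ?_⟩, rfl⟩⟩
    exact (Finset.le_sup (f := S) (Finset.mem_range.2 hm)).trans (le_of_max_le_right ht)

/-- Translation of oracle codes into codes of partial recursive functions taking a finite part of
the oracle as an additional argument. -/
def toCode (q : Nat.Partrec.Code) : OracleCode → Nat.Partrec.Code
  | zero => .zero
  | succ => .comp .succ .right
  | left => .comp .left .right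
  | right => .comp .right .right
  | oracle => q
  | pair c d => .pair (toCode q c) (toCode q d)
  | comp c d => .comp (toCode q c) (.pair .left (toCode q d))
  | prec c d => .comp
      (.prec (toCode q c)
        (.comp (toCode q d)
          (.pair (.comp .left .left) (.pair (.comp .right .left) .right))))
      (.pair (.pair .left (.comp .left .right)) (.comp .right .right))
  | rfind' c => .comp
      (.rfind' (.comp (toCode q c)
        (.pair (.comp .left .left) (.pair (.comp .right .left) .right))))
      (.pair (.pair .left (.comp .left .right)) (.comp .right .right))

theorem mem_eval_toCode {q : Nat.Partrec.Code} {o : ℕ → ℕ → ℕ → Prop}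
    (hq : ∀ a n v, v ∈ q.eval (Nat.pair a n) ↔ o a n v) (c : OracleCode) (a : ℕ) :
    ∀ n v, v ∈ (toCode q c).eval (Nat.pair a n) ↔ Computes (o a) c n v := by
  have hpair : ∀ (c d : Nat.Partrec.Code) n v, v ∈ (c.pair d).eval n ↔
      ∃ a, a ∈ c.eval n ∧ ∃ b, b ∈ d.eval n ∧ Nat.pair a b = v := fun _ _ _ _ => mem_seq_pair
  have hcomp : ∀ (c d : Nat.Partrec.Code) n v, v ∈ (c.comp d).eval n ↔
      ∃ a, a ∈ d.eval n ∧ v ∈ c.eval a := fun _ _ _ _ => Part.mem_bind_iff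
  have hleft : ∀ n v, v ∈ Nat.Partrec.Code.left.eval n ↔ v = n.unpair.1 :=
    fun _ _ => Part.mem_some_iff
  have hright : ∀ n v, v ∈ Nat.Partrec.Code.right.eval n ↔ v = n.unpair.2 :=
    fun _ _ => Part.mem_some_iff
  have hsucc : ∀ n v, v ∈ Nat.Partrec.Code.succ.eval n ↔ v = n + 1 := fun _ _ => Part.mem_some_iff
  -- `prec` and `rfind'` read their input as a parameter and a counter, so the code `a` of the
  -- finite oracle has to be moved into the parameter before the recursion (`hre'`) and moved back
  -- out for each call of the body (`hre`).
  have hre : ∀ n v, v ∈ ((Nat.Partrec.Code.left.comp .left).pair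
      ((Nat.Partrec.Code.right.comp .left).pair .right)).eval n ↔
      v = Nat.pair n.unpair.1.unpair.1 (Nat.pair n.unpair.1.unpair.2 n.unpair.2) := by
    intro n v
    simp [hpair, hcomp, hleft, hright, eq_comm]
  have hre' : ∀ n v, v ∈ ((Nat.Partrec.Code.left.pair (.comp .left .right)).pair
      (Nat.Partrec.Code.right.comp .right)).eval n ↔
      v = Nat.pair (Nat.pair n.unpair.1 n.unpair.2.unpair.1) n.unpair.2.unpair.2 := by
    intro n v
    simp [hpair, hcomp, hleft, hright, eq_comm]
  induction c with
  | zero => exact fun _ _ => Part.mem_some_iff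
  | succ | left | right => intro n v; simp [toCode, Computes, hcomp, hleft, hright, hsucc]
  | oracle => exact hq a
  | pair c d hc hd => intro n v; simp only [toCode, Computes, hpair, hc, hd]
  | comp c d hc hd => intro n v; simp [toCode, Computes, hcomp, hpair, hleft, hd, hc]
  | prec c d hc hd =>
    intro n v
    simp only [toCode, hcomp _ _ _ v, hre', exists_eq_left, Computes, Nat.unpair_pair]
    induction n.unpair.2 generalizing v with
    | zero =>
      rw [Nat.Partrec.Code.eval_prec_zero]
      exact hc _ _
    | succ k ih =>
      rw [Nat.Partrec.Code.eval_prec_succ]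
      refine Part.mem_bind_iff.trans (exists_congr fun i => and_congr (ih i) ?_)
      simp [hcomp, hre, hd]
  | rfind' c hc =>
    intro n v
    simp only [toCode, hcomp _ _ _ v, hre', exists_eq_left, Computes]
    refine (Part.mem_map_iff _).trans ?_
    simp only [Nat.unpair_pair]
    refine exists_congr fun k => and_congr_left fun _ => mem_rfind_map.trans ?_
    simp [hcomp, hre, hc]

end OracleCode

/-! ### Uniform finite approximations of oracle computations -/

namespace OracleCode

open Encodable

/-- Definition by cases on whether a number is `0`, `1`, `2`, `3`, `4` or greater. -/
def fiveCases {σ : Type*} (c : ℕ → σ) (s : ℕ → σ) : ℕ → σ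
  | 0 => c 0
  | 1 => c 1
  | 2 => c 2
  | 3 => c 3
  | 4 => c 4
  | n + 5 => s n

theorem primrec_fiveCases {σ τ : Type*} [Primcodable σ] [Primcodable τ] (c : ℕ → σ)
    {s : List τ × ℕ → σ} (hs : Primrec s) :
    Primrec fun l : List τ => fiveCases c (fun n => s (l, n)) l.length := by
  have : ∀ k, PrimrecPred fun l : List τ => l.length = k := fun k =>
    Primrec.eq.comp .list_length (.const k)
  refine (Primrec.ite (this 0) (.const (c 0)) <| Primrec.ite (this 1) (.const (c 1)) <|
    Primrec.ite (this 2) (.const (c 2)) <| Primrec.ite (this 3) (.const (c 3)) <|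
    Primrec.ite (this 4) (.const (c 4)) <|
    hs.comp (Primrec.id.pair (Primrec.nat_sub.comp .list_length (.const 5)))).of_eq fun l => ?_
  rcases h : l.length with _ | _ | _ | _ | _ | n <;> simp [fiveCases]

theorem primrec_toCode_ofNat (q : Nat.Partrec.Code) : Primrec fun n => toCode q (ofNat n) := by
  let R : Nat.Partrec.Code := ((Nat.Partrec.Code.left.comp .left).pair
    ((Nat.Partrec.Code.right.comp .left).pair .right))
  let R' : Nat.Partrec.Code := ((Nat.Partrec.Code.left.pair (.comp .left .right)).pair
    (Nat.Partrec.Code.right.comp .right))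
  have hcomp : Primrec₂ Nat.Partrec.Code.comp := Nat.Partrec.Code.primrec₂_comp
  have hpair : Primrec₂ Nat.Partrec.Code.pair := Nat.Partrec.Code.primrec₂_pair
  let step : List Nat.Partrec.Code × ℕ → Option Nat.Partrec.Code := fun p =>
    p.1[p.2.div2.div2]?.bind fun s => p.1[p.2.div2.div2.unpair.1]?.bind fun s₁ =>
      p.1[p.2.div2.div2.unpair.2]?.map fun s₂ =>
        cond p.2.bodd
          (cond p.2.div2.bodd (Nat.Partrec.Code.comp (.rfind' (.comp s R)) R')
            (.comp (.prec s₁ (.comp s₂ R)) R'))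
          (cond p.2.div2.bodd (.comp s₁ (.pair .left s₂)) (.pair s₁ s₂))
  have hstep : Primrec step := by
    have hm : Primrec fun p : List Nat.Partrec.Code × ℕ => p.2.div2.div2 :=
      Primrec.nat_div2.comp (Primrec.nat_div2.comp .snd)
    have hmu : Primrec fun p : List Nat.Partrec.Code × ℕ => p.2.div2.div2.unpair :=
      Primrec.unpair.comp hm
    refine Primrec.option_bind (Primrec.list_getElem?.comp .fst hm) (.mk <|
      Primrec.option_bind
        ((Primrec.list_getElem?.comp .fst (Primrec.fst.comp hmu)).comp .fst) (.mk <|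
      Primrec.option_map ((Primrec.list_getElem?.comp .fst (Primrec.snd.comp hmu)).comp
        (Primrec.fst.comp .fst)) (.mk ?_)))
    have hn : Primrec fun p : (((List Nat.Partrec.Code × ℕ) × Nat.Partrec.Code) ×
        Nat.Partrec.Code) × Nat.Partrec.Code => p.1.1.1.2 :=
      Primrec.snd.comp (Primrec.fst.comp (Primrec.fst.comp .fst))
    have hs : Primrec fun p : (((List Nat.Partrec.Code × ℕ) × Nat.Partrec.Code) ×
        Nat.Partrec.Code) × Nat.Partrec.Code => p.1.1.2 :=
      Primrec.snd.comp (Primrec.fst.comp .fst)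
    have hs₁ : Primrec fun p : (((List Nat.Partrec.Code × ℕ) × Nat.Partrec.Code) ×
        Nat.Partrec.Code) × Nat.Partrec.Code => p.1.2 := Primrec.snd.comp .fst
    have hb := Primrec.nat_bodd.comp hn
    have hb₂ := Primrec.nat_bodd.comp (Primrec.nat_div2.comp hn)
    have h₁ := hcomp.comp (Nat.Partrec.Code.primrec_rfind'.comp (hcomp.comp hs (.const R)))
      (.const R')
    have h₂ := hcomp.comp (Nat.Partrec.Code.primrec₂_prec.comp hs₁ (hcomp.comp .snd (.const R)))
      (.const R')
    have h₃ := hcomp.comp hs₁ (hpair.comp (.const .left) .snd)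
    have h₄ := hpair.comp hs₁ .snd
    exact (hb.cond (hb₂.cond h₁ h₂) (hb₂.cond h₃ h₄)).of_eq fun _ => rfl
  refine (Primrec.nat_strong_rec (fun (_ : Unit) n => toCode q (ofNat n))
    (g := fun _ l => fiveCases (fun n => some (toCode q (ofNat n))) (fun n => step (l, n)) l.length)
    ((primrec_fiveCases _ hstep).comp .snd).to₂ fun _ n => ?_).comp (.const ()) .id
  simp only [List.length_map, List.length_range]
  rcases n with _ | _ | _ | _ | _ | n
  iterate 5 rfl
  have hm : n.div2.div2 < n + 5 := by
    simp only [Nat.div2_val]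
    omega
  have h₁ := lt_of_le_of_lt n.div2.div2.unpair_left_le hm
  have h₂ := lt_of_le_of_lt n.div2.div2.unpair_right_le hm
  simp only [fiveCases, step, List.getElem?_map, List.getElem?_range, hm, h₁, h₂, Option.map_some,
    Option.bind_some, Option.some.injEq]
  rw [ofNat.eq_6]
  cases n.bodd <;> cases n.div2.bodd <;> rfl

/-- The approximation with oracle string `σ` runs `|σ|` steps on every prefix of `σ` and takes the
first answer. Shorter prefixes have to be tried because `evaln k` accepts only inputs below `k`, and
the code of `σ` itself is not below `|σ|`. Trying all of them also makes the approximation monotone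
in `σ`. -/
theorem exists_approx : ∃ A : ℕ → List ℕ → ℕ → Option ℕ,
    (Computable fun p : ℕ × List ℕ × ℕ => A p.1 p.2.1 p.2.2) ∧
    (∀ e σ τ n v, σ <+: τ → A e σ n = some v → A e τ n = some v) ∧
    ∀ e y n v, v ∈ turingFunctional e y n ↔ ∃ s, A e (initialSegment y s) n = some v := by
  obtain ⟨q, hq⟩ : ∃ q : Nat.Partrec.Code, ∀ a n v, v ∈ q.eval (Nat.pair a n) ↔
      v ∈ (Denumerable.ofNat (List ℕ) a)[n]? := by
    have : Partrec fun p : ℕ => ((Denumerable.ofNat (List ℕ) p.unpair.1)[p.unpair.2]? : Part ℕ) :=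
      Computable.ofOption (Computable.list_getElem?.comp
        ((Computable.ofNat _).comp (Computable.fst.comp Computable.unpair))
        (Computable.snd.comp Computable.unpair))
    obtain ⟨q, hq⟩ := Nat.Partrec.Code.exists_code.1 (Partrec.nat_iff.1 this)
    exact ⟨q, fun a n v => by rw [hq]; simp⟩
  let B : ℕ → List ℕ → ℕ → ℕ → Option ℕ := fun e σ n j =>
    (toCode q (ofNat e)).evaln σ.length (Nat.pair (encode (σ.take j)) n)
  let A : ℕ → List ℕ → ℕ → Option ℕ := fun e σ n =>
    ((List.range (σ.length + 1)).flatMap fun j => (B e σ n j).toList).head?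
  have hA : ∀ {e σ n v}, A e σ n = some v → ∃ j ≤ σ.length, B e σ n j = some v := by
    intro e σ n v h
    have := List.mem_of_mem_head? h
    simp only [List.mem_flatMap, List.mem_range, Option.mem_toList] at this
    obtain ⟨j, hj, h⟩ := this
    exact ⟨j, Nat.lt_succ_iff.1 hj, h⟩
  have hA' : ∀ {e σ n j v}, j ≤ σ.length → B e σ n j = some v → ∃ w, A e σ n = some w := by
    intro e σ n j v hj h
    have : v ∈ (List.range (σ.length + 1)).flatMap fun j => (B e σ n j).toList := by
      simp only [List.mem_flatMap, List.mem_range, Option.mem_toList]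
      exact ⟨j, Nat.lt_succ_iff.2 hj, h⟩
    cases hl : (List.range (σ.length + 1)).flatMap fun j => (B e σ n j).toList with
    | nil => simp [hl] at this
    | cons w l => exact ⟨w, by simp only [A, hl, List.head?_cons]⟩
  have hB : ∀ {e σ n j v} {y : ℕ → ℕ}, (∀ i w, σ[i]? = some w → w = y i) → B e σ n j = some v →
      v ∈ turingFunctional e y n := by
    intro e σ n j v y hy h
    refine (mem_eval ..).2 (Computes.mono ?_
      ((mem_eval_toCode hq _ _ _ _).1 (Nat.Partrec.Code.evaln_sound h)))
    intro i w hw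
    rw [Denumerable.ofNat_encode] at hw
    refine hy i w ?_
    rw [Option.mem_def, List.getElem?_take] at hw
    split at hw
    · exact hw
    · cases hw
  have hseg : ∀ {y : ℕ → ℕ} {s i w}, (initialSegment y s)[i]? = some w → w = y i := by
    intro y s i w h
    simp only [initialSegment, List.getElem?_map, Option.map_eq_some_iff] at h
    obtain ⟨j, hj, rfl⟩ := h
    rw [(List.getElem?_eq_some_iff.1 hj).2.symm, List.getElem_range]
  refine ⟨A, ?_, ?_, ?_⟩
  · have hB : Primrec fun p : (ℕ × List ℕ × ℕ) × ℕ => B p.1.1 p.1.2.1 p.1.2.2 p.2 :=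
      Nat.Partrec.Code.primrec_evaln.comp
        (((Primrec.list_length.comp (Primrec.fst.comp (Primrec.snd.comp .fst))).pair
          ((primrec_toCode_ofNat q).comp (Primrec.fst.comp .fst))).pair
        (Primrec₂.natPair.comp (Primrec.encode.comp (Primrec.list_take.comp .snd
          (Primrec.fst.comp (Primrec.snd.comp .fst))))
          (Primrec.snd.comp (Primrec.snd.comp .fst))))
    have htoList : Primrec (Option.toList : Option ℕ → List ℕ) :=
      (Primrec.option_casesOn (g := fun (_ : Option ℕ) b => [b]) .id (.const [])
        (Primrec.list_cons.comp .snd (.const []) : Primrec fun p : Option ℕ × ℕ => [p.2])).of_eq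
        fun o => by cases o <;> rfl
    exact (Primrec.list_head?.comp (Primrec.list_flatMap
      (Primrec.list_range.comp (Primrec.succ.comp (Primrec.list_length.comp
        (Primrec.fst.comp .snd)))) (htoList.comp hB).to₂)).to_comp
  · intro e σ τ n v hστ h
    obtain ⟨j, hj, hB1⟩ := hA h
    have : B e τ n j = some v := by
      have ht : τ.take j = σ.take j := by
        obtain ⟨ρ, rfl⟩ := hστ
        rw [List.take_append_of_le_length hj]
      simp only [B, ht]
      exact Nat.Partrec.Code.evaln_mono hστ.length_le hB1
    obtain ⟨w, hw⟩ := hA' (hj.trans hστ.length_le) this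
    obtain ⟨k, hk, hB2⟩ := hA hw
    -- Different prefixes cannot give different answers: all these computations are correct for the
    -- one total oracle that continues `τ` by zeros.
    have hy : ∀ i w, τ[i]? = some w → w = (fun i => τ.getD i 0) i := by
      intro i w h
      simp [List.getD, h]
    rw [hw, Part.mem_unique (hB hy hB2) (hB hy this)]
  · intro e y n v
    constructor
    · intro h
      obtain ⟨s, hs⟩ := ((mem_eval ..).1 h).exists_initialSegment
      have h1 := (mem_eval_toCode (o := fun a n v => v ∈ (Denumerable.ofNat (List ℕ) a)[n]?) hq
        (ofNat e) (encode (initialSegment y s)) n v).2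
        (by simpa only [Denumerable.ofNat_encode] using hs s le_rfl)
      obtain ⟨k, hk⟩ := Nat.Partrec.Code.evaln_complete.1 h1
      have hlen : (initialSegment y (max s k)).length = max s k := by simp [initialSegment]
      have : B e (initialSegment y (max s k)) n s = some v := by
        have ht : (initialSegment y (max s k)).take s = initialSegment y s := by
          simp [initialSegment, ← List.map_take, List.take_range]
        simp only [B, ht, hlen]
        exact Nat.Partrec.Code.evaln_mono (le_max_right _ _) hk
      obtain ⟨w, hw⟩ := hA' (by rw [hlen]; exact le_max_left _ _) this
      obtain ⟨j, -, hj⟩ := hA hw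
      exact ⟨_, by rw [hw, Part.mem_unique (hB (fun _ _ => hseg) hj) h]⟩
    · rintro ⟨s, hs⟩
      obtain ⟨j, -, hj⟩ := hA hs
      exact hB (fun _ _ => hseg) hj

end OracleCode

/-! ### Diagonally avoiding functions -/

/-- The set of oracles consisting of a single real. -/
abbrev oracleOf (y : ℕ → ℕ) : Set (ℕ →. ℕ) :=
  {(y : ℕ →. ℕ)}

theorem realReducible_iff {x y : ℕ → ℕ} : RealReducible x y ↔ ComputableIn (oracleOf y) x :=
  Iff.rfl

theorem computableIn_oracleOf (y : ℕ → ℕ) : ComputableIn (oracleOf y) y :=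
  TuringReducible.refl _

theorem ComputableIn.trans {α σ : Type*} [Primcodable α] [Primcodable σ] {x y : ℕ → ℕ} {f : α → σ}
    (hf : ComputableIn (oracleOf x) f) (hx : ComputableIn (oracleOf y) x) :
    ComputableIn (oracleOf y) f :=
  RecursiveIn.subst hf fun _ hg => Set.mem_singleton_iff.1 hg ▸ hx

theorem DecidableIn.trans {α : Type*} [Primcodable α] {x y : ℕ → ℕ} {P : α → Prop}
    (hP : DecidableIn (oracleOf x) P) (hx : ComputableIn (oracleOf y) x) :
    DecidableIn (oracleOf y) P :=
  let ⟨f, hf, h⟩ := hP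
  ⟨f, hf.trans hx, h⟩

theorem RealReducible.trans {x y z : ℕ → ℕ} (h : RealReducible x y) (h' : RealReducible y z) :
    RealReducible x z :=
  TuringReducible.trans h h'

open OracleCode in
/-- A form of the recursion theorem: the program `F` may refer to its own index. -/
theorem exists_selfIndex {y : ℕ → ℕ} {F : ℕ → ℕ →. ℕ}
    (hF : RecursiveIn (oracleOf y) fun p : ℕ => F p.unpair.1 p.unpair.2) :
    ∃ n, ∀ a m, turingFunctional (appIndex n (Nat.pair n a)) y m = F n a := by
  -- No fixed point is needed: `n` is an index of `F` as a function of a pair, and `n` itself is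
  -- supplied as the first component of the input.
  obtain ⟨n, hn⟩ := exists_turingFunctional_eq hF
  refine ⟨n, fun a m => ?_⟩
  rw [turingFunctional_appIndex, hn]
  simp

/-- `z` is a `0`-`1`-valued function that is diagonally nonrecursive relative to `y`. -/
structure AvoidsDiagonal (z y : ℕ → ℕ) : Prop where
  lt_two : ∀ e, z e < 2
  notMem : ∀ e, z e ∉ turingFunctional e y e

/-- A function that is diagonally nonrecursive relative to `y` computes, uniformly, correct choices
among finitely many `Π⁰₁` statements relative to `y` at least one of which is true. -/
theorem AvoidsDiagonal.exists_choice {y z : ℕ → ℕ} (h : AvoidsDiagonal z y) {R : ℕ → ℕ → ℕ → Prop}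
    (hR : DecidableIn (oracleOf y) fun p : ℕ × ℕ × ℕ => R p.1 p.2.1 p.2.2) {b : ℕ → ℕ}
    (hb : Computable b) : ∃ G : ℕ → ℕ, ComputableIn (oracleOf z) G ∧
      ∀ a, (∃ i < b a, ∀ s, R a i s) → G a < b a ∧ ∀ s, R a (G a) s := by
  classical
  have hfst : ComputableIn (oracleOf y) fun p : ℕ => p.unpair.1 :=
    ComputableIn.fst.comp ComputableIn.unpair
  have hsnd : ComputableIn (oracleOf y) fun p : ℕ => p.unpair.2 :=
    ComputableIn.snd.comp ComputableIn.unpair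
  have hfst' : ComputableIn (oracleOf y) fun p : ℕ × ℕ => p.1.unpair.1 := hfst.comp .fst
  have hsnd' : ComputableIn (oracleOf y) fun p : ℕ × ℕ => p.1.unpair.2 := hsnd.comp .fst
  have h1 : DecidableIn (oracleOf y) fun p : ℕ × ℕ => ∃ t < p.2, ¬ R p.1.unpair.1 p.1.unpair.2 t :=
    DecidableIn.exists_lt (P := fun (p : ℕ × ℕ) t => ¬ R p.1.unpair.1 p.1.unpair.2 t) .snd
      (hR.comp ((hfst'.comp .fst).pair ((hsnd'.comp .fst).pair .snd))).not
  have h2 : DecidableIn (oracleOf y) fun p : ℕ × ℕ => ∀ j < b p.1.unpair.1, p.1.unpair.2 < j →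
      ∃ t < p.2, ¬ R p.1.unpair.1 j t := by
    refine DecidableIn.forall_lt (P := fun (p : ℕ × ℕ) j => p.1.unpair.2 < j → ∃ t < p.2, ¬ R p.1.unpair.1 j t)
      (hb.computableIn.comp hfst') (.imp (.lt (hsnd'.comp .fst) .snd) ?_)
    exact DecidableIn.exists_lt (P := fun (q : (ℕ × ℕ) × ℕ) t => ¬ R q.1.1.unpair.1 q.2 t)
      (ComputableIn.snd.comp .fst)
      (hR.comp ((hfst'.comp (ComputableIn.fst.comp .fst)).pair
        ((ComputableIn.snd.comp .fst).pair .snd))).not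
  -- On input `(a, i)` the program waits until statement `i` is refuted, and outputs 0, or until all
  -- candidates after `i` are refuted, and outputs 1. Since `z` differs from the output, `z = 0`
  -- excludes the first outcome and `z = 1` the second.
  obtain ⟨F, hF, hFspec⟩ := DecidableIn.rfind_map
    (P := fun (p : ℕ) s => (∃ t < s, ¬ R p.unpair.1 p.unpair.2 t) ∨ ∀ j < b p.unpair.1, p.unpair.2 < j →
      ∃ t < s, ¬ R p.unpair.1 j t)
    (g := fun (p : ℕ) s => if ∃ t < s, ¬ R p.unpair.1 p.unpair.2 t then 0 else 1) (h1.or h2)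
    (h1.ite (.const 0) (.const 1))
  obtain ⟨n, hn⟩ := OracleCode.exists_turingFunctional_eq hF
  let e : ℕ → ℕ → ℕ := fun a i => OracleCode.appIndex n (Nat.pair a i)
  have hz : ∀ a i, z (e a i) ∉ F (Nat.pair a i) := by
    intro a i hi
    refine h.notMem (e a i) ?_
    rwa [OracleCode.turingFunctional_appIndex, hn]
  have he : ComputableIn (oracleOf z) fun p : ℕ × ℕ => z (e p.1 p.2) :=
    (computableIn_oracleOf z).comp (OracleCode.primrec_appIndex.comp
      ((Primrec.const n).pair Primrec₂.natPair)).computableIn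
  -- Move through the candidates as long as `z` says 1, and stop at the first 0 or at the last
  -- candidate.
  obtain ⟨G, hG, hGspec⟩ := DecidableIn.find (O := oracleOf z)
    (P := fun a i => z (e a i) = 0 ∨ b a ≤ i + 1)
    ((DecidableIn.eq he (.const 0)).or (.le (hb.computableIn.comp .fst)
      (ComputableIn.succ.comp .snd))) fun a => ⟨b a, Or.inr (Nat.le_succ _)⟩
  refine ⟨G, hG, fun a ha => ?_⟩
  obtain ⟨hG1, hG2⟩ := hGspec a
  -- A true candidate is never left behind for good: if `i` were the last true one, the program
  -- would output 1 at `i`, which is the value of `z` there.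
  have key : ∀ i ≤ G a, ∃ j < b a, i ≤ j ∧ ∀ s, R a j s := by
    intro i hi
    induction i with
    | zero => obtain ⟨j, hj, hj'⟩ := ha; exact ⟨j, hj, Nat.zero_le _, hj'⟩
    | succ i ih =>
      by_contra hcon
      push Not at hcon
      obtain ⟨j, hj, hij, hRj⟩ := ih (Nat.le_of_succ_le hi)
      obtain rfl : i = j := by
        by_contra hne
        obtain ⟨s, hs⟩ := hcon j hj (lt_of_le_of_ne hij hne)
        exact hs (hRj s)
      have hzi : z (e a i) = 1 := by
        have := h.lt_two (e a i)
        have := hG2 i hi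
        omega
      have hex : ∃ s, ∀ j < b a, i < j → ∃ t < s, ¬ R a j t := by
        choose! S hS using hcon
        refine ⟨(Finset.range (b a)).sup S + 1, fun j hj hij => ⟨S j, ?_, hS j hj hij⟩⟩
        exact Nat.lt_succ_of_le (Finset.le_sup (f := S) (Finset.mem_range.2 hj))
      refine hz a i ((hFspec _ _).2 ?_)
      simp only [Nat.unpair_pair, hRj, not_true_eq_false, and_false, exists_false, false_or,
        if_false, hzi]
      exact ⟨Nat.find hex, Nat.find_spec hex, fun t ht => Nat.find_min hex ht, trivial⟩
  obtain ⟨j, hj, hij, hRj⟩ := key _ le_rfl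
  refine ⟨hij.trans_lt hj, ?_⟩
  rcases hG1 with hG1 | hG1
  · by_contra hcon
    push Not at hcon
    have hne : ¬ j ≤ G a := fun hle => by
      obtain rfl := le_antisymm hle hij
      obtain ⟨s, hs⟩ := hcon
      exact hs (hRj s)
    have hno : ∀ s, ¬ ∀ j < b a, G a < j → ∃ t < s, ¬ R a j t := by
      intro s hs
      obtain ⟨t, -, ht⟩ := hs j hj (not_le.1 hne)
      exact ht (hRj t)
    have hex : ∃ s, ∃ t < s, ¬ R a (G a) t := by
      obtain ⟨s, hs⟩ := hcon
      exact ⟨s + 1, s, Nat.lt_succ_self s, hs⟩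
    refine hz a (G a) ((hFspec _ _).2 ?_)
    simp only [Nat.unpair_pair, hno, or_false]
    refine ⟨Nat.find hex, Nat.find_spec hex, fun t ht => Nat.find_min hex ht, ?_⟩
    rw [if_pos (Nat.find_spec hex), hG1]
  · obtain rfl : j = G a := by omega
    exact hRj

/-- Exactly one of `y n = v` and `y n ≠ v` holds, and both are decidable in `y`, hence Π⁰₁ with a
dummy stage. A correct choice between them decides the graph of `y`, and the value `y n` is then
found by search. -/
theorem AvoidsDiagonal.realReducible {y z : ℕ → ℕ} (h : AvoidsDiagonal z y) :
    RealReducible y z := by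
  obtain ⟨G, hG, hGspec⟩ := h.exists_choice
    (R := fun a i _ => i = 0 ↔ y a.unpair.1 = a.unpair.2) (b := fun _ => 2) (by
      have h1 : DecidableIn (oracleOf y) fun p : ℕ × ℕ × ℕ => p.2.1 = 0 :=
        .eq (ComputableIn.fst.comp .snd) (.const 0)
      have h2 : DecidableIn (oracleOf y) fun p : ℕ × ℕ × ℕ => y p.1.unpair.1 = p.1.unpair.2 :=
        .eq ((computableIn_oracleOf y).comp (ComputableIn.fst.comp
          (ComputableIn.unpair.comp .fst))) (ComputableIn.snd.comp (ComputableIn.unpair.comp .fst))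
      exact ((h1.imp h2).and (h2.imp h1)).of_iff fun _ => iff_def.symm) (.const 2)
  have hG' : ∀ n v, G (Nat.pair n v) = 0 ↔ y n = v := by
    intro n v
    have : ∃ i < 2, ∀ _ : ℕ, (i = 0 ↔ y n = v) := by
      by_cases hv : y n = v
      · exact ⟨0, by omega, fun _ => by simp [hv]⟩
      · exact ⟨1, by omega, fun _ => by simp [hv]⟩
    simpa using (hGspec (Nat.pair n v) (by simpa using this)).2 0
  obtain ⟨f, hf, hfspec⟩ := DecidableIn.find (O := oracleOf z)
    (P := fun n v => G (Nat.pair n v) = 0)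
    (.eq (hG.comp Primrec₂.natPair.computableIn) (.const 0)) fun n => ⟨y n, (hG' _ _).2 rfl⟩
  exact hf.of_eq fun n => ((hG' _ _).1 (hfspec n).1).symm

/-! ### Models generated by increasing sequences of reals -/

section Generated

variable {x : ℕ → ℕ → ℕ}

theorem mem_generatedBy_iff {A : Set ℕ} :
    A ∈ generatedBy x ↔ ∃ n, DecidableIn (oracleOf (x n)) fun k => k ∈ A := by
  refine exists_congr fun n => ⟨fun h => ?_, fun h => ?_⟩
  exact (DecidableIn.eq (realReducible_iff.1 h) (.const 1)).of_iff fun k => by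
    by_cases hk : k ∈ A <;> simp [hk]
  · classical exact (h.ite (.const 1) (.const 0)).of_eq fun k => by congr

theorem realMem_generatedBy_iff {f : ℕ → ℕ} :
    RealMem (generatedBy x) f ↔ ∃ n, RealReducible f (x n) := by
  refine mem_generatedBy_iff.trans (exists_congr fun n => ⟨fun h => ?_, fun h => ?_⟩)
  · obtain ⟨g, hg, hgspec⟩ := DecidableIn.find (P := fun a v => ∃ m, Nat.pair a v = Nat.pair m (f m))
      (h.comp Primrec₂.natPair.computableIn) fun a => ⟨f a, a, rfl⟩
    refine ComputableIn.of_eq hg fun a => ?_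
    obtain ⟨m, hm⟩ := (hgspec a).1
    obtain ⟨rfl, hm⟩ := Nat.pair_eq_pair.1 hm
    exact hm
  · refine (DecidableIn.eq ComputableIn.id (Primrec₂.natPair.computableIn.comp
      ((ComputableIn.fst.comp .unpair).pair ((realReducible_iff.1 h).comp
        (ComputableIn.fst.comp .unpair))))).of_iff fun k => ?_
    constructor
    · exact fun hk => ⟨_, hk⟩
    · rintro ⟨m, rfl⟩
      simp

theorem stringSetMem_generatedBy_iff {T : Set (List ℕ)} :
    StringSetMem (generatedBy x) T ↔ ∃ n, DecidableIn (oracleOf (x n)) fun σ : List ℕ => σ ∈ T := by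
  refine mem_generatedBy_iff.trans (exists_congr fun n => ⟨fun h => ?_, fun h => ?_⟩)
  · exact (h.comp Computable.encode.computableIn).of_iff fun σ =>
      Encodable.encode_injective.mem_set_image
  · refine (h.comp (Computable.ofNat (List ℕ)).computableIn).of_iff fun k => ?_
    constructor
    · exact fun hk => ⟨_, hk, Denumerable.encode_ofNat k⟩
    · rintro ⟨σ, hσ, rfl⟩
      rwa [Denumerable.ofNat_encode]

variable (hx : ∀ m n, m ≤ n → RealReducible (x m) (x n))

local notation "Mω" => omegaModel (generatedBy x) (generatedBy_nonempty x)

/-- The value of a term in an `ω`-model. -/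
def omegaEval (I : Set (Set ℕ)) (hI : I.Nonempty) (t : L2Term) (v : ℕ → ℕ) : ℕ :=
  t.eval (omegaModel I hI) v

/-- Satisfaction in an `ω`-model. -/
def OmegaSat (I : Set (Set ℕ)) (hI : I.Nonempty) (φ : L2Formula) (v : ℕ → ℕ) (V : ℕ → Set ℕ) :
    Prop :=
  φ.Sat (omegaModel I hI) v V

theorem computableIn_omegaEval {α : Type} [Primcodable α] {O : Set (ℕ →. ℕ)} {I : Set (Set ℕ)}
    {hI : I.Nonempty} {w : α → ℕ → ℕ} (hw : ∀ i, Computable fun a => w a i) (t : L2Term) :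
    ComputableIn O fun a => omegaEval I hI t (w a) := by
  induction t with
  | var i => exact (hw i).computableIn
  | zero => exact .const 0
  | one => exact .const 1
  | add s t hs ht => exact Primrec.nat_add.computableIn.comp (hs.pair ht)
  | mul s t hs ht => exact Primrec.nat_mul.computableIn.comp (hs.pair ht)

theorem L2Term.eval_update_of_not_hasVar {M : L2Structure} {v : ℕ → M.N} {i : ℕ} {n : M.N}
    {t : L2Term} (ht : ¬ t.HasVar i) : t.eval M (Function.update v i n) = t.eval M v := by
  induction t with
  | var j => exact Function.update_of_ne (fun h => ht h.symm) _ _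
  | zero | one => rfl
  | add s t hs ht' | mul s t hs ht' =>
    simp only [L2Term.HasVar, not_or] at ht
    simp only [L2Term.eval, hs ht.1, ht' ht.2]

theorem computable_update {α : Type} [Primcodable α] {w : α → ℕ → ℕ}
    (hw : ∀ i, Computable fun a => w a i) (x : ℕ) (i : ℕ) :
    Computable fun p : α × ℕ => Function.update (w p.1) x p.2 i := by
  by_cases h : i = x
  · subst h
    exact Computable.snd.of_eq fun p => by simp
  · exact ((hw i).comp .fst).of_eq fun p => (Function.update_of_ne h ..).symm

include hx in
-- The claim is made for all large `m`, so that subformulas whose parameters appear at different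
-- places in the chain can be combined, and for assignments depending computably on any `α`, so that
-- a bounded quantifier is handled by passing to `α × ℕ`.
theorem exists_decidableIn_sat {V : ℕ → Set ℕ} (hV : ∀ i, V i ∈ generatedBy x) {θ : L2Formula}
    (hθ : θ.IsBounded) : ∃ m₀, ∀ m ≥ m₀, ∀ (α : Type) [Primcodable α] (w : α → ℕ → ℕ),
      (∀ i, Computable fun a => w a i) →
        DecidableIn (oracleOf (x m)) fun a => OmegaSat _ (generatedBy_nonempty x) θ (w a) V := by
  have hlt : ∀ (v : ℕ → ℕ) (i n : ℕ) (t : L2Term), ¬ t.HasVar i →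
      (n < omegaEval _ (generatedBy_nonempty x) t v ↔
        OmegaSat _ (generatedBy_nonempty x) (.lt (.var i) t) (Function.update v i n) V) := by
    intro v i n t ht
    change n < _ ↔ Function.update v i n i < _
    rw [Function.update_self]
    exact iff_of_eq (congrArg (n < ·) (L2Term.eval_update_of_not_hasVar (M := Mω) ht).symm)
  induction hθ with
  | eq s t =>
    exact ⟨0, fun m _ α _ w hw => .eq (β := ℕ) (computableIn_omegaEval hw s) (computableIn_omegaEval hw t)⟩
  | lt s t =>
    exact ⟨0, fun m _ α _ w hw => .lt (computableIn_omegaEval hw s) (computableIn_omegaEval hw t)⟩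
  | mem t X =>
    obtain ⟨m₀, hm₀⟩ := mem_generatedBy_iff.1 (hV X)
    exact ⟨m₀, fun m hm α _ w hw => (hm₀.trans (hx _ _ hm)).comp (computableIn_omegaEval hw t)⟩
  | not _ ih =>
    obtain ⟨m₀, h⟩ := ih
    exact ⟨m₀, fun m hm α _ w hw => (h m hm α w hw).not⟩
  | and _ _ ih ih' =>
    obtain ⟨m₀, h⟩ := ih
    obtain ⟨m₁, h'⟩ := ih'
    exact ⟨max m₀ m₁, fun m hm α _ w hw => (h m (le_of_max_le_left hm) α w hw).and
      (h' m (le_of_max_le_right hm) α w hw)⟩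
  | or _ _ ih ih' =>
    obtain ⟨m₀, h⟩ := ih
    obtain ⟨m₁, h'⟩ := ih'
    exact ⟨max m₀ m₁, fun m hm α _ w hw => (h m (le_of_max_le_left hm) α w hw).or
      (h' m (le_of_max_le_right hm) α w hw)⟩
  | imp _ _ ih ih' =>
    obtain ⟨m₀, h⟩ := ih
    obtain ⟨m₁, h'⟩ := ih'
    exact ⟨max m₀ m₁, fun m hm α _ w hw => (h m (le_of_max_le_left hm) α w hw).imp
      (h' m (le_of_max_le_right hm) α w hw)⟩
  | @ballLt i t φ ht _ ih =>
    obtain ⟨m₀, h⟩ := ih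
    refine ⟨m₀, fun m hm α _ w hw => (DecidableIn.forall_lt
      (P := fun a n => OmegaSat _ (generatedBy_nonempty x) φ (Function.update (w a) i n) V)
      (computableIn_omegaEval (hI := generatedBy_nonempty x) hw t)
      (h m hm (α × ℕ) _ (computable_update hw i))).of_iff fun a => forall_congr' fun n => ?_⟩
    refine imp_congr_left (hlt _ _ _ _ ht)
  | @bexLt i t φ ht _ ih =>
    obtain ⟨m₀, h⟩ := ih
    refine ⟨m₀, fun m hm α _ w hw => (DecidableIn.exists_lt
      (P := fun a n => OmegaSat _ (generatedBy_nonempty x) φ (Function.update (w a) i n) V)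
      (computableIn_omegaEval (hI := generatedBy_nonempty x) hw t)
      (h m hm (α × ℕ) _ (computable_update hw i))).of_iff fun a => exists_congr fun n => ?_⟩
    refine and_congr_left' (hlt _ _ _ _ ht)

include hx in
theorem rca0_generatedBy : (Mω).RCA0 where
  basic :=
    { succ_ne_zero := Nat.succ_ne_zero
      succ_inj := fun _ _ => Nat.succ.inj
      add_zero := Nat.add_zero
      add_succ := Nat.add_succ
      mul_zero := Nat.mul_zero
      mul_succ := Nat.mul_succ
      not_lt_zero := Nat.not_lt_zero
      lt_succ := fun _ _ => Nat.lt_succ_iff_lt_or_eq }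
  induction := fun _ _ _ _ _ _ h0 hs n => Nat.rec h0 hs n
  comprehension := by
    rintro _ _ ⟨i, θ, hθ, rfl⟩ ⟨j, θ', hθ', rfl⟩ k (v : ℕ → ℕ) V hV H
    obtain ⟨m₀, h⟩ := exists_decidableIn_sat hx hV hθ
    obtain ⟨m₁, h'⟩ := exists_decidableIn_sat hx hV hθ'
    have hw : ∀ l, Computable fun n : ℕ => Function.update v k n l := fun l =>
      (computable_update (w := fun (_ : ℕ) => v) (fun i => Computable.const (v i)) k l).comp
        (Computable.id.pair .id)
    replace h := h _ (le_max_left m₀ m₁) _ _ (computable_update hw i)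
    replace h' := h' _ (le_max_right m₀ m₁) _ _ (computable_update hw j)
    -- Search at once for a witness of the Σ⁰₁ form and a counterexample to the Π⁰₁ form; their
    -- equivalence ensures that one is found.
    obtain ⟨f, hf, hfspec⟩ := DecidableIn.find (P := fun n s =>
      OmegaSat _ (generatedBy_nonempty x) θ (Function.update (Function.update v k n) i s) V ∨
        ¬ OmegaSat _ (generatedBy_nonempty x) θ' (Function.update (Function.update v k n) j s) V) (h.or h'.not) (by
      intro n
      by_cases hn : ∃ s : ℕ, OmegaSat _ (generatedBy_nonempty x) θ
          (Function.update (Function.update v k n) i s) V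
      · exact hn.imp fun _ => Or.inl
      · have := mt (H n).2 hn
        exact (not_forall.1 this).imp fun _ => Or.inr)
    refine ⟨{n | OmegaSat _ (generatedBy_nonempty x) (.ex i θ) (Function.update v k n) V},
      mem_generatedBy_iff.2 ⟨_, (h.comp (ComputableIn.id.pair hf)).of_iff fun n => ?_⟩,
      fun n => Iff.rfl⟩
    refine ⟨fun hn => ⟨_, hn⟩, fun hn => (hfspec n).1.resolve_right fun hc => hc ?_⟩
    exact (H n).1 hn _

end Generated

/-! ### Paths through infinite binary trees -/

section WeakKoenig

/-- In the coding of binary strings by numbers, the code `σ` of a string has an extension in `T` that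
is longer by `s`. -/
def HasDescendant (T : Set ℕ) (σ s : ℕ) : Prop :=
  ∃ j < 2 ^ s, (σ + 1) * 2 ^ s + j - 1 ∈ T

variable {T : Set ℕ}

/-- Adding 1 to codes turns appending a bit `i` into `c ↦ 2 * c + i`, so the descendants of `σ` at
relative depth `s` have the consecutive codes `(σ + 1) * 2 ^ s + j - 1`. The lower half of the range
of `j` lies below the first child and the upper half below the second. -/
theorem hasDescendant_succ {σ s : ℕ} :
    HasDescendant T σ (s + 1) ↔ HasDescendant T (2 * σ + 1) s ∨ HasDescendant T (2 * σ + 2) s := by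
  unfold HasDescendant
  have h1 : ∀ j, (σ + 1) * 2 ^ (s + 1) + j = (2 * σ + 1 + 1) * 2 ^ s + j := fun j => by ring
  have h2 : ∀ j, (σ + 1) * 2 ^ (s + 1) + (2 ^ s + j) = (2 * σ + 2 + 1) * 2 ^ s + j :=
    fun j => by ring
  constructor
  · rintro ⟨j, hj, hT⟩
    rcases lt_or_ge j (2 ^ s) with h | h
    · exact Or.inl ⟨j, h, by rwa [← h1]⟩
    · obtain ⟨i, rfl⟩ := Nat.exists_eq_add_of_le h
      exact Or.inr ⟨i, by rw [pow_succ] at hj; omega, by rwa [← h2]⟩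
  · rintro (⟨j, hj, hT⟩ | ⟨j, hj, hT⟩)
    · exact ⟨j, by rw [pow_succ]; omega, by rwa [h1]⟩
    · exact ⟨2 ^ s + j, by rw [pow_succ]; omega, by rwa [h2]⟩

theorem hasDescendant_zero {σ : ℕ} : HasDescendant T σ 0 ↔ σ ∈ T := by
  simp [HasDescendant]

variable (hT : ∀ σ, (2 * σ + 1 ∈ T → σ ∈ T) ∧ (2 * σ + 2 ∈ T → σ ∈ T))
include hT

theorem HasDescendant.of_succ {σ s : ℕ} (h : HasDescendant T σ (s + 1)) : HasDescendant T σ s := by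
  induction s generalizing σ with
  | zero =>
    rw [hasDescendant_succ] at h
    simp only [hasDescendant_zero] at h ⊢
    exact h.elim (hT σ).1 (hT σ).2
  | succ s ih =>
    rw [hasDescendant_succ] at h ⊢
    exact h.imp ih ih

theorem HasDescendant.mono {σ s t : ℕ} (hst : s ≤ t) (h : HasDescendant T σ t) :
    HasDescendant T σ s := by
  induction t, hst using Nat.le_induction with
  | base => exact h
  | succ t _ ih => exact ih (h.of_succ hT)

theorem exists_child_hasDescendant {σ : ℕ} (h : ∀ s, HasDescendant T σ s) :
    ∃ i < 2, ∀ s, HasDescendant T (2 * σ + 1 + i) s := by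
  by_contra hcon
  push Not at hcon
  obtain ⟨s, hs⟩ := hcon 0 (by omega)
  obtain ⟨t, ht⟩ := hcon 1 (by omega)
  rcases hasDescendant_succ.1 (h (max s t + 1)) with h' | h'
  · exact hs (h'.mono hT (le_max_left _ _))
  · exact ht (h'.mono hT (le_max_right _ _))

omit hT in
theorem hasDescendant_root (hT : ∀ σ, (2 * σ + 1 ∈ T → σ ∈ T) ∧ (2 * σ + 2 ∈ T → σ ∈ T))
    (hinf : ∀ m, ∃ σ ∈ T, m < σ) (s : ℕ) : HasDescendant T 0 s := by
  obtain ⟨τ, hτ, hlt⟩ := hinf (2 ^ s)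
  -- The string coded by `τ` has length `log₂ (τ + 1)`.
  refine HasDescendant.mono hT (t := Nat.log 2 (τ + 1)) ?_ ⟨τ + 1 - 2 ^ Nat.log 2 (τ + 1), ?_, ?_⟩
  · exact Nat.le_log_of_pow_le (by norm_num) (by omega)
  · have := Nat.lt_pow_succ_log_self (b := 2) (by norm_num) (τ + 1)
    rw [pow_succ] at this
    omega
  · have := Nat.pow_log_le_self 2 (x := τ + 1) (by omega)
    rwa [zero_add, one_mul, Nat.add_sub_cancel' this]

/-- An infinite binary tree recursive in `y` has a path recursive in any function that is
diagonally nonrecursive relative to `y`. -/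
theorem AvoidsDiagonal.exists_path {y z : ℕ → ℕ} (h : AvoidsDiagonal z y)
    (hTy : DecidableIn (oracleOf y) fun σ => σ ∈ T) (hinf : ∀ m, ∃ σ ∈ T, m < σ) :
    ∃ P : Set ℕ, DecidableIn (oracleOf z) (fun σ => σ ∈ P) ∧ P ⊆ T ∧ 0 ∈ P ∧
      ∀ σ, (σ ∈ P → 2 * σ + 1 ∈ P ∧ 2 * σ + 2 ∉ P ∨ 2 * σ + 1 ∉ P ∧ 2 * σ + 2 ∈ P) ∧
        (2 * σ + 1 ∈ P → σ ∈ P) ∧ (2 * σ + 2 ∈ P → σ ∈ P) := by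
  have hpow : Primrec₂ fun a b : ℕ => a ^ b :=
    (Primrec.nat_rec' (f := fun p : ℕ × ℕ => p.2) (g := fun _ => 1) (h := fun p q => q.2 * p.1)
      .snd (.const 1) (Primrec.nat_mul.comp (Primrec.snd.comp .snd) (Primrec.fst.comp .fst)).to₂).of_eq
      fun p => by induction p.2 <;> simp_all [pow_succ]
  -- Having descendants at all depths is a Π⁰₁(y) property, so `z` can choose a child that keeps it.
  obtain ⟨G, hG, hGspec⟩ := h.exists_choice (R := fun σ i s => HasDescendant T (2 * σ + 1 + i) s)
    (b := fun _ => 2) (by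
      refine DecidableIn.exists_lt (f := fun p : ℕ × ℕ × ℕ => 2 ^ p.2.2)
        (P := fun p j => (2 * p.1 + 1 + p.2.1 + 1) * 2 ^ p.2.2 + j - 1 ∈ T)
        (hpow.comp (.const 2) (Primrec.snd.comp .snd)).computableIn (hTy.comp ?_)
      exact (Primrec.nat_sub.comp (Primrec.nat_add.comp (Primrec.nat_mul.comp
        (Primrec.succ.comp (Primrec.nat_add.comp (Primrec.succ.comp (Primrec.nat_mul.comp (.const 2)
          (Primrec.fst.comp .fst))) (Primrec.fst.comp (Primrec.snd.comp .fst))))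
        (hpow.comp (.const 2) (Primrec.snd.comp (Primrec.snd.comp .fst)))) .snd)
        (.const 1)).computableIn) (.const 2)
  let p : ℕ → ℕ := fun n => Nat.rec (motive := fun _ => ℕ) 0 (fun _ σ => 2 * σ + 1 + G σ) n
  have hps : ∀ n, p (n + 1) = 2 * p n + 1 + G (p n) := fun _ => rfl
  have hp : ComputableIn (oracleOf z) p :=
    ComputableIn.nat_rec (h := fun _ _ σ => 2 * σ + 1 + G σ) .id (.const 0)
      (Primrec.nat_add.computableIn.comp
        (((Primrec.succ.comp (Primrec.nat_mul.comp (.const 2) .id)).computableIn.comp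
          (ComputableIn.snd.comp .snd)).pair (hG.comp (ComputableIn.snd.comp .snd))))
  have hpT : ∀ n, ∀ s, HasDescendant T (p n) s := by
    intro n
    induction n with
    | zero => exact hasDescendant_root hT hinf
    | succ n ih => exact (hGspec _ (exists_child_hasDescendant hT ih)).2
  have hG2 : ∀ n, G (p n) < 2 := fun n => (hGspec _ (exists_child_hasDescendant hT (hpT n))).1
  have hmono : StrictMono p := strictMono_nat_of_lt_succ fun n => by rw [hps]; omega
  refine ⟨Set.range p, ?_, ?_, ⟨0, rfl⟩, ?_⟩
  -- The codes along the path increase strictly, so `p n = σ` forces `n ≤ σ` and the search is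
  -- bounded.
  · refine (DecidableIn.exists_lt (f := fun σ : ℕ => σ + 1) (P := fun σ n => p n = σ)
      ComputableIn.succ (.eq (hp.comp .snd) .fst)).of_iff fun σ => ?_
    refine ⟨fun ⟨n, _, hn⟩ => ⟨n, hn⟩, ?_⟩
    rintro ⟨n, rfl⟩
    exact ⟨n, Nat.lt_succ_of_le (hmono.id_le n), rfl⟩
  · rintro _ ⟨n, rfl⟩
    exact hasDescendant_zero.1 (hpT n 0)
  have hinj : ∀ {σ n i}, p (n + 1) = 2 * σ + 1 + i → i < 2 → p n = σ ∧ G (p n) = i := by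
    intro σ n i hn hi
    have := hG2 n
    rw [hps] at hn
    omega
  have hpred : ∀ {σ i}, i < 2 → 2 * σ + 1 + i ∈ Set.range p → σ ∈ Set.range p ∧ G σ = i := by
    rintro σ i hi ⟨n, hn⟩
    cases n with
    | zero => change 0 = _ at hn; omega
    | succ n =>
      obtain ⟨rfl, hG⟩ := hinj hn hi
      exact ⟨⟨n, rfl⟩, hG⟩
  have h0 : ∀ σ, 2 * σ + 1 ∈ Set.range p → σ ∈ Set.range p ∧ G σ = 0 :=
    fun σ => hpred (i := 0) (by omega)
  have h1 : ∀ σ, 2 * σ + 2 ∈ Set.range p → σ ∈ Set.range p ∧ G σ = 1 :=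
    fun σ => hpred (i := 1) (by omega)
  refine fun σ => ⟨?_, fun h => (h0 σ h).1, fun h => (h1 σ h).1⟩
  rintro ⟨n, rfl⟩
  have hn : p (n + 1) ∈ Set.range p := ⟨n + 1, rfl⟩
  rw [hps] at hn
  have := hG2 n
  interval_cases hg : G (p n)
  · exact Or.inl ⟨hn, fun h => by have := (h1 _ h).2; omega⟩
  · exact Or.inr ⟨fun h => by have := (h0 _ h).2; omega, hn⟩

end WeakKoenig

/-! ### Weak König's lemma holds and arithmetical comprehension fails in the generated model -/

section Generated

variable {x : ℕ → ℕ → ℕ}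

theorem wkl0_generatedBy (hx : ∀ m n, m ≤ n → RealReducible (x m) (x n))
    (hz : ∀ n, ∃ m z, RealReducible z (x m) ∧ AvoidsDiagonal z (x n)) :
    (omegaModel (generatedBy x) (generatedBy_nonempty x)).WKL0 where
  rca0 := rca0_generatedBy hx
  weakKoenig := by
    intro T hT htree hinf
    obtain ⟨n, hn⟩ := mem_generatedBy_iff.1 hT
    obtain ⟨m, z, hzm, hz⟩ := hz n
    have htree' : ∀ σ : ℕ, (σ + σ + 1 ∈ T → σ ∈ T) ∧ (σ + σ + 2 ∈ T → σ ∈ T) := htree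
    obtain ⟨P, hP, hPT, hP0, hPs⟩ := hz.exists_path (T := T) (by simpa only [two_mul]) hn hinf
    simp only [two_mul] at hPs
    exact ⟨P, mem_generatedBy_iff.2 ⟨m, hP.trans hzm⟩,
      ⟨fun σ => (hPs σ).2, hP0, fun σ hσ => (hPs σ).1 hσ⟩, hPT⟩

/-- If all reals `x n` are hyperimmune-free then the generated `ω`-model does not contain the
halting problem. -/
theorem not_arithmeticalComprehension_generatedBy (hx : ∀ n, HyperimmuneFree (x n)) :
    ¬ (omegaModel (generatedBy x) (generatedBy_nonempty x)).ArithmeticalComprehension := by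
  intro hACA
  -- The first component of `p` codes a program, which is run on `p` itself. The second component is
  -- padding: it makes every program occur at arbitrarily large `p`, as is needed against eventual
  -- domination.
  let ev : ℕ → ℕ → Option ℕ := fun s p =>
    Nat.Partrec.Code.evaln s (Denumerable.ofNat Nat.Partrec.Code p.unpair.1) p
  have hev : Primrec fun q : ℕ × ℕ => ev q.1 q.2 :=
    Nat.Partrec.Code.primrec_evaln.comp ((Primrec.fst.pair ((Primrec.ofNat _).comp
      (Primrec.fst.comp (Primrec.unpair.comp .snd)))).pair .snd)
  have hhalt : ∀ O : Set (ℕ →. ℕ), DecidableIn O fun q : ℕ × ℕ => (ev q.1 q.2).isSome = true :=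
    fun O => DecidableIn.of_computableIn (Primrec.option_isSome.comp hev).computableIn
  -- An injective pairing given by a polynomial, so that it can be written as a term of the
  -- language.
  have hpoly : Primrec fun q : ℕ × ℕ => (q.1 + q.2) * (q.1 + q.2) + q.1 :=
    Primrec.nat_add.comp (Primrec.nat_mul.comp (Primrec.nat_add.comp .fst .snd)
      (Primrec.nat_add.comp .fst .snd)) .fst
  have hinj : ∀ p s p' s' : ℕ, (p + s) * (p + s) + p = (p' + s') * (p' + s') + p' →
      p = p' ∧ s = s' := by
    intro p s p' s' h
    have : p + s = p' + s' := by
      rcases lt_trichotomy (p + s) (p' + s') with h' | h' | h' <;> nlinarith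
    rw [this] at h
    omega
  let A : Set ℕ := {m | ∃ p < m + 1, ∃ s < m + 1, (ev s p).isSome = true ∧
    (p + s) * (p + s) + p = m}
  have hA : A ∈ generatedBy x := by
    refine mem_generatedBy_iff.2 ⟨0, DecidableIn.exists_lt
      (P := fun m p => ∃ s < m + 1, (ev s p).isSome = true ∧ (p + s) * (p + s) + p = m) .succ
      (DecidableIn.exists_lt (P := fun q s => (ev s q.2).isSome = true ∧
        (q.2 + s) * (q.2 + s) + q.2 = q.1) (ComputableIn.succ.comp .fst) (.and ?_ (.eq ?_ ?_)))⟩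
    · exact (hhalt _).comp (ComputableIn.snd.pair (ComputableIn.snd.comp .fst))
    · exact (hpoly.comp ((Primrec.snd.comp .fst).pair .snd)).computableIn
    · exact ComputableIn.fst.comp .fst
  have hAmem : ∀ p s, (p + s) * (p + s) + p ∈ A ↔ (ev s p).isSome = true := by
    intro p s
    constructor
    · rintro ⟨p', -, s', -, h, heq⟩
      obtain ⟨rfl, rfl⟩ := hinj _ _ _ _ heq
      exact h
    · intro h
      exact ⟨p, by nlinarith, s, by nlinarith [Nat.zero_le (p * s), Nat.le_mul_self s], h, rfl⟩
  obtain ⟨(B : Set ℕ), hB, hBspec⟩ := hACA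
    (.ex 1 (.mem (.add (.mul (.add (.var 0) (.var 1)) (.add (.var 0) (.var 1))) (.var 0)) 0))
    trivial 0 (fun _ => (0 : ℕ)) (fun _ => A) fun _ => hA
  replace hBspec : ∀ p : ℕ, p ∈ B ↔ ∃ s, (ev s p).isSome = true := by
    intro p
    refine (hBspec p).trans (exists_congr fun s => ?_)
    exact Iff.trans (Iff.of_eq rfl) (hAmem p s)
  obtain ⟨n, hn⟩ := mem_generatedBy_iff.1 hB
  -- With `B` as an oracle, `t p` is a stage by which the computation `p` has halted if it ever
  -- does.
  obtain ⟨t, ht, htspec⟩ := DecidableIn.find (P := fun p s => p ∉ B ∨ (ev s p).isSome = true)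
    ((hn.comp .fst).not.or ((hhalt _).comp (ComputableIn.snd.pair .fst))) (by
      intro p
      by_cases hp : p ∈ B
      · exact ((hBspec p).1 hp).imp fun _ => Or.inr
      · exact ⟨0, Or.inl hp⟩)
  obtain ⟨g, hg, hdom⟩ := hx n (fun p => (ev (t p) p).getD 0 + 1)
    (ComputableIn.succ.comp (ComputableIn.option_getD
      (hev.computableIn.comp (ht.pair .id)) (.const 0)))
  obtain ⟨c, hc⟩ := Nat.Partrec.Code.exists_code.1 (Partrec.nat_iff.1 hg)
  obtain ⟨N, hN⟩ := Filter.eventually_atTop.1 hdom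
  -- At this `p ≥ N` the diverging function takes the value `g p + 1`, although `g` should bound it
  -- there.
  let p := Nat.pair (Encodable.encode c) N
  have hval : ∀ s v, ev s p = some v → v = g p := by
    intro s v h
    have := Nat.Partrec.Code.evaln_sound h
    simp only [p, Nat.unpair_pair, Denumerable.ofNat_encode, hc] at this
    exact Part.mem_some_iff.1 this
  have hpB : p ∈ B := by
    have : g p ∈ Nat.Partrec.Code.eval c p := by rw [hc]; exact Part.mem_some _
    obtain ⟨s, hs⟩ := Nat.Partrec.Code.evaln_complete.1 this
    refine (hBspec p).2 ⟨s, ?_⟩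
    have : ev s p = some (g p) := by
      simp only [ev, p, Nat.unpair_pair, Denumerable.ofNat_encode]
      exact hs
    rw [this]
    rfl
  have h := hN p (Nat.right_le_pair _ _)
  obtain ⟨v, hv⟩ := Option.isSome_iff_exists.1 ((htspec p).1.resolve_left (not_not.2 hpB))
  simp only [hv, Option.getD_some, hval _ _ hv] at h
  omega

end Generated

/-! ### Strings -/

theorem length_initialSegment (y : ℕ → ℕ) (n : ℕ) : (initialSegment y n).length = n := by
  simp [initialSegment]

theorem initialSegment_succ (y : ℕ → ℕ) (n : ℕ) :
    initialSegment y (n + 1) = initialSegment y n ++ [y n] := by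
  simp [initialSegment, List.range_succ]

theorem take_initialSegment {y : ℕ → ℕ} {m n : ℕ} (h : m ≤ n) :
    (initialSegment y n).take m = initialSegment y m := by
  simp [initialSegment, ← List.map_take, List.take_range, h]

theorem initialSegment_prefix {y : ℕ → ℕ} {m n : ℕ} (h : m ≤ n) :
    initialSegment y m <+: initialSegment y n :=
  take_initialSegment (y := y) h ▸ List.take_prefix _ _

theorem getElem?_initialSegment {y : ℕ → ℕ} {m n : ℕ} (h : m < n) :
    (initialSegment y n)[m]? = some (y m) := by
  simp [initialSegment, h]

theorem ComputableIn.initialSegment {O : Set (ℕ →. ℕ)} {y : ℕ → ℕ} (hy : ComputableIn O y) :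
    ComputableIn O (initialSegment y) :=
  list_map Primrec.list_range.computableIn (hy.comp .snd)

theorem ComputableIn.list_concat {α β : Type*} [Primcodable α] [Primcodable β]
    {O : Set (ℕ →. ℕ)} {f : α → List β} {g : α → β} (hf : ComputableIn O f)
    (hg : ComputableIn O g) : ComputableIn O fun a => f a ++ [g a] :=
  Computable.list_concat.computableIn.comp (hf.pair hg)

theorem ComputableIn.list_take {α β : Type*} [Primcodable α] [Primcodable β]
    {O : Set (ℕ →. ℕ)} {f : α → ℕ} {g : α → List β} (hf : ComputableIn O f)
    (hg : ComputableIn O g) : ComputableIn O fun a => (g a).take (f a) :=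
  Primrec.list_take.computableIn.comp (hf.pair hg)

theorem ComputableIn.flatMap_children {α : Type*} [Primcodable α] {O : Set (ℕ →. ℕ)}
    {f : α → List (List ℕ)} {m : α → ℕ} (hf : ComputableIn O f) (hm : ComputableIn O m) :
    ComputableIn O fun a => (f a).flatMap fun σ => (List.range (m a + 1)).map fun v => σ ++ [v] :=
  have hmap : ComputableIn O fun q : α × List ℕ =>
      (List.range (m q.1 + 1)).map fun v => q.2 ++ [v] :=
    .list_map (h := fun q v => q.2 ++ [v])
      (Primrec.list_range.computableIn.comp (ComputableIn.succ.comp (hm.comp .fst)))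
      (.list_concat (ComputableIn.snd.comp .fst) .snd)
  .list_flatMap (h := fun a σ => (List.range (m a + 1)).map fun v => σ ++ [v]) hf hmap

theorem ComputableIn.list_sum_map {α β : Type*} [Primcodable α] [Primcodable β]
    {O : Set (ℕ →. ℕ)} {f : α → List β} {h : α → β → ℕ} (hf : ComputableIn O f)
    (hh : ComputableIn O fun p : α × β => h p.1 p.2) :
    ComputableIn O fun a => ((f a).map (h a)).sum :=
  (ComputableIn.list_foldl (h := fun _ s v => s + v) (.list_map hf hh) (.const 0)
    (Primrec.nat_add.computableIn.comp .snd)).of_eq fun _ => List.sum_eq_foldl.symm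

/-- The strings of length `n` that are bounded by `g`. -/
def boundedStrings (g : ℕ → ℕ) (n : ℕ) : List (List ℕ) :=
  Nat.rec [[]] (fun k L => L.flatMap fun σ => (List.range (g k + 1)).map fun v => σ ++ [v]) n

theorem boundedStrings_succ (g : ℕ → ℕ) (n : ℕ) : boundedStrings g (n + 1) =
    (boundedStrings g n).flatMap fun σ => (List.range (g n + 1)).map fun v => σ ++ [v] :=
  rfl

theorem computable_boundedStrings {g : ℕ → ℕ} (hg : Computable g) {O : Set (ℕ →. ℕ)} :
    ComputableIn O (boundedStrings g) := 
  have hstep := ComputableIn.flatMap_children (α := ℕ × ℕ × List (List ℕ)) (O := O)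
    (ComputableIn.snd.comp .snd)
    (hg.computableIn.comp (ComputableIn.fst.comp .snd))
  ComputableIn.nat_rec (α := ℕ) (σ := List (List ℕ)) (f := fun n => n) (g := fun _ => [[]])
    (h := fun _ k L => L.flatMap fun σ => (List.range (g k + 1)).map fun v => σ ++ [v])
    .id (.const _) hstep

theorem length_of_mem_boundedStrings {g : ℕ → ℕ} {n : ℕ} {σ : List ℕ}
    (h : σ ∈ boundedStrings g n) : σ.length = n := by
  induction n generalizing σ with
  | zero => simpa [boundedStrings] using h
  | succ n ih =>
    simp only [boundedStrings_succ, List.mem_flatMap, List.mem_map] at h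
    obtain ⟨τ, hτ, v, -, rfl⟩ := h
    simp [ih hτ]

theorem initialSegment_mem_boundedStrings {g y : ℕ → ℕ} {n : ℕ} (h : ∀ k < n, y k ≤ g k) :
    initialSegment y n ∈ boundedStrings g n := by
  induction n with
  | zero => simp [boundedStrings, initialSegment]
  | succ n ih =>
    simp only [boundedStrings_succ, List.mem_flatMap, List.mem_map, List.mem_range]
    exact ⟨_, ih fun k hk => h k (hk.trans (Nat.lt_succ_self n)), y n,
      Nat.lt_succ_of_le (h n (Nat.lt_succ_self n)), (initialSegment_succ y n).symm⟩

/-! ### Hyperimmune-free reals -/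

theorem Computable.exists_le_of_eventually_le {f g : ℕ → ℕ} (hg : Computable g)
    (h : ∀ᶠ n in Filter.atTop, f n ≤ g n) : ∃ g' : ℕ → ℕ, Computable g' ∧ ∀ n, f n ≤ g' n := by
  obtain ⟨N, hN⟩ := Filter.eventually_atTop.1 h
  refine ⟨fun n => g n + (Finset.range N).sup f,
    Primrec.nat_add.to_comp.comp hg (.const _), fun n => ?_⟩
  rcases lt_or_ge n N with hn | hn
  · exact (Finset.le_sup (f := f) (Finset.mem_range.2 hn)).trans (Nat.le_add_left _ _)
  · exact (hN n hn).trans (Nat.le_add_right _ _)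

theorem HyperimmuneFree.exists_le {x f : ℕ → ℕ} (hx : HyperimmuneFree x)
    (hf : ComputableIn (oracleOf x) f) : ∃ g : ℕ → ℕ, Computable g ∧ ∀ n, f n ≤ g n :=
  let ⟨_, hg, h⟩ := hx f hf
  hg.exists_le_of_eventually_le h

theorem hyperimmuneFree_zero : HyperimmuneFree fun _ => 0 := fun f hf => by
  refine ⟨f, TuringReducible.partrec_of_const (s := Part.some 0) hf, .of_forall fun _ => le_rfl⟩

/-- The real that is the characteristic function of a set of numbers. -/
def boolReal (b : ℕ → Bool) (n : ℕ) : ℕ :=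
  (b n).toNat

/-- The class of sets of numbers all of whose initial segments satisfy `T`. -/
def treeClass (T : List ℕ → Prop) : Set (ℕ → Bool) :=
  {b | ∀ n, T (initialSegment (boolReal b) n)}

theorem isClosed_setOf_initialSegment (T : List ℕ → Prop) (n : ℕ) :
    IsClosed {b : ℕ → Bool | T (initialSegment (boolReal b) n)} := by
  have hcont : Continuous fun (b : ℕ → Bool) (i : Fin n) => b i :=
    continuous_pi fun i => continuous_apply _
  have : {b : ℕ → Bool | T (initialSegment (boolReal b) n)} =
      (fun (b : ℕ → Bool) (i : Fin n) => b i) ⁻¹'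
        {c : Fin n → Bool | T ((List.finRange n).map fun i : Fin n => (c i).toNat)} := by
    ext b
    simp only [Set.mem_ofPred_eq, Set.mem_preimage]
    have : initialSegment (boolReal b) n = (List.finRange n).map fun i : Fin n => (b i).toNat := by
      refine List.ext_getElem (by simp [initialSegment]) fun i h1 h2 => ?_
      simp [initialSegment, boolReal]
    rw [this]
  rw [this]
  exact (isClosed_discrete _).preimage hcont

theorem isClosed_treeClass (T : List ℕ → Prop) : IsClosed (treeClass T) := by
  rw [treeClass, Set.ofPred_forall]
  exact isClosed_iInter fun n => isClosed_setOf_initialSegment T n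

/-- Compactness of Cantor space. As `T` need not be closed under initial segments, the failure is
located at some length up to `l`, not at `l` itself. -/
theorem exists_le_not_of_treeClass_eq_empty {T : List ℕ → Prop} (h : treeClass T = ∅) :
    ∃ l, ∀ b : ℕ → Bool, ∃ j ≤ l, ¬ T (initialSegment (boolReal b) j) := by
  by_contra hcon
  push Not at hcon
  have : (⋂ l, {b : ℕ → Bool | ∀ j ≤ l, T (initialSegment (boolReal b) j)}).Nonempty := by
    refine IsCompact.nonempty_iInter_of_sequence_nonempty_isCompact_isClosed _
      (fun l b hb j hj => hb j (hj.trans (Nat.le_succ l))) hcon ?_ ?_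
    · refine IsClosed.isCompact ?_
      simp only [Set.ofPred_forall]
      exact isClosed_iInter fun j => isClosed_iInter fun _ => isClosed_setOf_initialSegment T j
    · intro l
      simp only [Set.ofPred_forall]
      exact isClosed_iInter fun j => isClosed_iInter fun _ => isClosed_setOf_initialSegment T j
  obtain ⟨b, hb⟩ := this
  have : b ∈ treeClass T := fun n => Set.mem_iInter.1 hb n n le_rfl
  rw [h] at this
  exact this

theorem mem_boundedStrings_one_iff {σ : List ℕ} {l : ℕ} :
    σ ∈ boundedStrings (fun _ => 1) l ↔ ∃ b, initialSegment (boolReal b) l = σ := by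
  constructor
  · intro h
    induction l generalizing σ with
    | zero => exact ⟨fun _ => false, by simpa [boundedStrings, eq_comm, initialSegment] using h⟩
    | succ l ih =>
      simp only [boundedStrings_succ, List.mem_flatMap, List.mem_map, List.mem_range] at h
      obtain ⟨τ, hτ, v, hv, rfl⟩ := h
      obtain ⟨b, rfl⟩ := ih hτ
      refine ⟨Function.update b l (decide (v = 1)), ?_⟩
      rw [initialSegment_succ]
      congr 1
      · refine List.map_congr_left fun i hi => ?_
        rw [boolReal, Function.update_of_ne (List.mem_range.1 hi).ne, boolReal]
      · rw [boolReal, Function.update_self]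
        interval_cases v <;> rfl
  · rintro ⟨b, rfl⟩
    exact initialSegment_mem_boundedStrings fun k _ => by
      rw [boolReal]; cases b k <;> simp

/-- The hyperimmune-free basis theorem for a class given by a tree recursive in a hyperimmune-free
real. -/
theorem HyperimmuneFree.exists_mem_treeClass {y : ℕ → ℕ} (hy : HyperimmuneFree y)
    {T : List ℕ → Prop} (hT : DecidableIn (oracleOf y) T) (hne : (treeClass T).Nonempty) :
    ∃ b ∈ treeClass T, HyperimmuneFree (boolReal b) := by
  classical
  obtain ⟨A, hA, hAmono, hAspec⟩ := OracleCode.exists_approx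
  have hAc : ∀ e, ComputableIn (oracleOf y) fun p : List ℕ × ℕ => A e p.1 p.2 := fun e =>
    hA.computableIn.comp ((ComputableIn.const e).pair .id)
  let C : Type := {S : List ℕ → Prop // DecidableIn (oracleOf y) S ∧ (treeClass S).Nonempty}
  have hnone : ∀ (S : C) (e n : ℕ),
      DecidableIn (oracleOf y) fun σ => S.1 σ ∧ A e σ n = none := fun S e n =>
    S.2.1.and (.eq ((hAc e).comp (ComputableIn.id.pair (.const n))) (.const none))
  let step : ℕ → C → C := fun e S =>
    -- Make the `e`-th functional partial, by passing to a subclass on which it diverges at some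
    -- `n`, whenever such a subclass is nonempty.
    if h : ∃ n, (treeClass fun σ => S.1 σ ∧ A e σ n = none).Nonempty then
      ⟨_, hnone S e h.choose, h.choose_spec⟩
    else S
  let S : ℕ → C := fun k => Nat.rec ⟨T, hT, hne⟩ step k
  have hstep : ∀ e S, treeClass (step e S).1 ⊆ treeClass S.1 := by
    intro e S
    by_cases h : ∃ n, (treeClass fun σ => S.1 σ ∧ A e σ n = none).Nonempty
    · simp only [step, dif_pos h]
      exact fun b hb n => (hb n).1
    · simp only [step, dif_neg h]
      exact subset_rfl
  obtain ⟨b, hb⟩ : (⋂ k, treeClass (S k).1).Nonempty :=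
    IsCompact.nonempty_iInter_of_sequence_nonempty_isCompact_isClosed _
      (fun k => hstep k (S k)) (fun k => (S k).2.2) (isClosed_treeClass _).isCompact
      fun k => isClosed_treeClass _
  replace hb := Set.mem_iInter.1 hb
  refine ⟨b, hb 0, fun f hf => ?_⟩
  obtain ⟨e, he⟩ := OracleCode.exists_turingFunctional_eq hf
  have hfval : ∀ n v, (∃ s, A e (initialSegment (boolReal b) s) n = some v) ↔ f n = v := by
    intro n v
    rw [← hAspec, he]
    simp [eq_comm]
  have hb' := hb (e + 1)
  change b ∈ treeClass (step e (S e)).1 at hb'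
  by_cases h : ∃ n, (treeClass fun σ => (S e).1 σ ∧ A e σ n = none).Nonempty
  · simp only [step, dif_pos h] at hb'
    obtain ⟨s, hs⟩ := (hfval h.choose _).2 rfl
    rw [(hb' s).2] at hs
    cases hs
  · push Not at h
    have hb1 : ComputableIn (oracleOf y) (boundedStrings fun _ => 1) :=
      computable_boundedStrings (.const 1)
    -- If divergence could not be forced, then for every `n` there is, by compactness, a length at
    -- which each binary string has left the class or made the computation at `n` converge. Such a
    -- length is found recursively in `y`.
    obtain ⟨l, hl, hlspec⟩ := DecidableIn.find (O := oracleOf y) (α := ℕ)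
      (P := fun n l => ∀ σ ∈ boundedStrings (fun _ => 1) l, ∃ j < l + 1,
        ¬ ((S e).1 (σ.take j) ∧ A e (σ.take j) n = none)) (by
      refine DecidableIn.forall_mem (hb1.comp .snd) (DecidableIn.exists_lt
        (P := fun (q : (ℕ × ℕ) × List ℕ) j => ¬ ((S e).1 (q.2.take j) ∧ A e (q.2.take j) q.1.1 = none))
        (ComputableIn.succ.comp (ComputableIn.snd.comp .fst)) (DecidableIn.not ?_))
      have htake : ComputableIn (oracleOf y) fun q : ((ℕ × ℕ) × List ℕ) × ℕ => q.1.2.take q.2 :=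
        .list_take .snd (ComputableIn.snd.comp .fst)
      have hR : DecidableIn (oracleOf y) fun q : List ℕ × ℕ => (S e).1 q.1 ∧ A e q.1 q.2 = none :=
        ((S e).2.1.comp .fst).and (.eq (hAc e) (.const none))
      exact hR.comp (f := fun q : ((ℕ × ℕ) × List ℕ) × ℕ => (q.1.2.take q.2, q.1.1.1))
        (htake.pair (ComputableIn.fst.comp (ComputableIn.fst.comp .fst)))) (by
      intro n
      obtain ⟨l, hl⟩ := exists_le_not_of_treeClass_eq_empty (h n)
      refine ⟨l, fun σ hσ => ?_⟩
      obtain ⟨b, rfl⟩ := mem_boundedStrings_one_iff.1 hσ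
      obtain ⟨j, hj, hj'⟩ := hl b
      exact ⟨j, Nat.lt_succ_of_le hj, by rwa [take_initialSegment hj]⟩)
    have hlist : ComputableIn (oracleOf y) fun n => boundedStrings (fun _ => 1) (l n) :=
      hb1.comp hl
    have hval : ComputableIn (oracleOf y) fun p : ℕ × List ℕ => (A e p.2 p.1).getD 0 :=
      .option_getD ((hAc e).comp (ComputableIn.snd.pair .fst)) (.const 0)
    -- The sum over all strings of that length bounds every possible value; it is recursive in `y`,
    -- and therefore dominated by a recursive function.
    obtain ⟨g, hg, hdom⟩ := hy _ (ComputableIn.list_sum_map (h := fun n σ => (A e σ n).getD 0) hlist hval)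
    refine ⟨g, hg, hdom.mono fun n hn => le_trans ?_ hn⟩
    have hmem : initialSegment (boolReal b) (l n) ∈ boundedStrings (fun _ => 1) (l n) :=
      mem_boundedStrings_one_iff.2 ⟨b, rfl⟩
    obtain ⟨j, hj, hj'⟩ := (hlspec n).1 _ hmem
    rw [take_initialSegment (Nat.lt_succ_iff.1 hj)] at hj'
    have hS : (S e).1 (initialSegment (boolReal b) j) := hb e j
    obtain ⟨v, hv⟩ := Option.ne_none_iff_exists'.1 (not_and.1 hj' hS)
    have hv' := hAmono _ _ _ _ _ (initialSegment_prefix (Nat.lt_succ_iff.1 hj)) hv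
    have hfv := (hfval n v).1 ⟨_, hv⟩
    refine List.single_le_sum (by simp) _ (List.mem_map.2 ⟨_, hmem, ?_⟩)
    rw [hv', hfv]
    rfl

theorem HyperimmuneFree.exists_avoidsDiagonal {y : ℕ → ℕ} (hy : HyperimmuneFree y) :
    ∃ z, HyperimmuneFree z ∧ AvoidsDiagonal z y := by
  classical
  obtain ⟨A, hA, hAmono, hAspec⟩ := OracleCode.exists_approx
  let T : List ℕ → Prop := fun σ => ∀ e < σ.length,
    A e (initialSegment y σ.length) e = none ∨ A e (initialSegment y σ.length) e ≠ σ[e]?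
  have hT : DecidableIn (oracleOf y) T := by
    have hlen : ComputableIn (oracleOf y) fun σ : List ℕ => σ.length :=
      Computable.list_length.computableIn
    have hAe : ComputableIn (oracleOf y) fun p : List ℕ × ℕ =>
        A p.2 (initialSegment y p.1.length) p.2 :=
      hA.computableIn.comp (ComputableIn.snd.pair
        (((computableIn_oracleOf y).initialSegment.comp (hlen.comp .fst)).pair .snd))
    exact DecidableIn.forall_lt (P := fun σ e => A e (initialSegment y σ.length) e = none ∨
      A e (initialSegment y σ.length) e ≠ σ[e]?) hlen
      ((DecidableIn.eq hAe (.const none)).or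
        (DecidableIn.eq hAe Computable.list_getElem?.computableIn).not)
  have hTmem : ∀ b, b ∈ treeClass T ↔ ∀ e, boolReal b e ∉ turingFunctional e y e := by
    intro b
    constructor
    · intro hb e he
      obtain ⟨s, hs⟩ := (hAspec _ _ _ _).1 he
      have := hb (max s (e + 1)) e (by rw [length_initialSegment]; omega)
      rw [length_initialSegment, getElem?_initialSegment (by omega),
        hAmono _ _ _ _ _ (initialSegment_prefix (le_max_left _ _)) hs] at this
      simp at this
    · intro hb n e he
      rw [length_initialSegment] at he ⊢
      rw [getElem?_initialSegment he, or_iff_not_imp_right, not_not]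
      exact fun h => (hb e ((hAspec _ _ _ _).2 ⟨n, h⟩)).elim
  have hne : (treeClass T).Nonempty := by
    -- The value is 1 where the diagonal computation gives 0, and 0 everywhere else.
    refine ⟨fun e => decide (0 ∈ turingFunctional e y e), (hTmem _).2 fun e he => ?_⟩
    by_cases h : 0 ∈ turingFunctional e y e
    · simp only [boolReal, h, decide_true] at he
      exact absurd (Part.mem_unique h he) (by simp)
    · simp [boolReal, h] at he
  obtain ⟨b, hb, hif⟩ := hy.exists_mem_treeClass hT hne
  exact ⟨boolReal b, hif, fun e => by rw [boolReal]; cases b e <;> simp, (hTmem b).1 hb⟩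

/-! ### Perfect subtrees -/

theorem DecidableIn.isPrefix {α β : Type*} [Primcodable α] [Primcodable β] {O : Set (ℕ →. ℕ)}
    {f g : α → List β} (hf : ComputableIn O f) (hg : ComputableIn O g) :
    DecidableIn O fun a => f a <+: g a :=
  (DecidableIn.eq hf (.list_take (Computable.list_length.computableIn.comp hf) hg)).of_iff
    fun _ => List.prefix_iff_eq_take.symm

section Pruning

variable (Ψ : List ℕ → ℕ → Option ℕ) (u g : ℕ → ℕ) (T : Set (List ℕ)) (θ : List ℕ → ℕ)

/-- If `s` is large enough, the strings of `C` that extend `σ` give both values at `e`. -/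
def Splits (C : List (List ℕ)) (σ : List ℕ) (e s : ℕ) : Prop :=
  u e ≤ s → ∀ i < 2, ∃ τ ∈ C, σ <+: τ ∧ Ψ (τ.take (u e)) e = some i

open scoped Classical in
/-- The strings in `C` above no string that `C` fails to split. -/
noncomputable def prune (s : ℕ) (C : List (List ℕ)) : List (List ℕ) :=
  C.filter fun τ => ∀ l < s + 1, Splits Ψ u C (τ.take l) (θ (τ.take l)) s

open scoped Classical in
/-- The children in `T`, bounded by `g`, of the strings in `prune Ψ u θ s C`. -/
noncomputable def levelStep (s : ℕ) (C : List (List ℕ)) : List (List ℕ) :=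
  ((prune Ψ u θ s C).flatMap fun σ => (List.range (g s + 1)).map fun v => σ ++ [v]).filter
    fun τ => τ ∈ T

/-- The `s`-th level of the pruned tree. -/
noncomputable def level (s : ℕ) : List (List ℕ) :=
  Nat.rec [[]] (levelStep Ψ u g T θ) s

/-- `σ` has extensions on all levels of the pruned tree. -/
def Survives (σ : List ℕ) : Prop :=
  ∀ s, σ.length ≤ s → ∃ τ ∈ prune Ψ u θ s (level Ψ u g T θ s), σ <+: τ

variable {Ψ u g T θ}

theorem mem_prune_iff {s : ℕ} {C : List (List ℕ)} {τ : List ℕ} : τ ∈ prune Ψ u θ s C ↔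
    τ ∈ C ∧ ∀ l ≤ s, Splits Ψ u C (τ.take l) (θ (τ.take l)) s := by
  simp [prune]

theorem mem_level_succ_iff {s : ℕ} {τ : List ℕ} : τ ∈ level Ψ u g T θ (s + 1) ↔
    (∃ σ ∈ prune Ψ u θ s (level Ψ u g T θ s), ∃ v ≤ g s, σ ++ [v] = τ) ∧ τ ∈ T := by
  change τ ∈ levelStep Ψ u g T θ s (level Ψ u g T θ s) ↔ _
  simp [levelStep]

theorem mem_level_zero_iff {τ : List ℕ} : τ ∈ level Ψ u g T θ 0 ↔ τ = [] := by
  simp [level]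

theorem mem_boundedStrings_of_mem_level {s : ℕ} {τ : List ℕ} (h : τ ∈ level Ψ u g T θ s) :
    τ ∈ boundedStrings g s := by
  induction s generalizing τ with
  | zero => simpa [boundedStrings, mem_level_zero_iff] using h
  | succ s ih =>
    obtain ⟨⟨σ, hσ, v, hv, rfl⟩, -⟩ := mem_level_succ_iff.1 h
    simp only [boundedStrings_succ, List.mem_flatMap, List.mem_map, List.mem_range]
    exact ⟨σ, ih (mem_prune_iff.1 hσ).1, v, Nat.lt_succ_of_le hv, rfl⟩

theorem length_of_mem_level {s : ℕ} {τ : List ℕ} (h : τ ∈ level Ψ u g T θ s) : τ.length = s :=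
  length_of_mem_boundedStrings (mem_boundedStrings_of_mem_level h)

theorem mem_of_mem_level (hT : [] ∈ T) {s : ℕ} {τ : List ℕ} (h : τ ∈ level Ψ u g T θ s) :
    τ ∈ T := by
  cases s with
  | zero => rwa [mem_level_zero_iff.1 h]
  | succ s => exact (mem_level_succ_iff.1 h).2

/-- The next level extends only unpruned strings, so the pruned levels together are closed under
initial segments. -/
theorem take_mem_prune_level {s t : ℕ} (hst : s ≤ t) {τ : List ℕ}
    (h : τ ∈ prune Ψ u θ t (level Ψ u g T θ t)) :
    τ.take s ∈ prune Ψ u θ s (level Ψ u g T θ s) := by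
  induction t, hst using Nat.le_induction generalizing τ with
  | base => rwa [List.take_of_length_le (length_of_mem_level (mem_prune_iff.1 h).1).le]
  | succ t hst ih =>
    obtain ⟨⟨σ, hσ, v, -, rfl⟩, -⟩ := mem_level_succ_iff.1 (mem_prune_iff.1 h).1
    rw [List.take_append_of_le_length
      (by rwa [length_of_mem_level (mem_prune_iff.1 hσ).1])]
    exact ih hσ

theorem take_mem_prune_of_mem_level {s : ℕ} {τ : List ℕ} (h : τ ∈ level Ψ u g T θ (s + 1)) :
    τ.take s ∈ prune Ψ u θ s (level Ψ u g T θ s) := by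
  obtain ⟨⟨σ, hσ, v, -, rfl⟩, -⟩ := mem_level_succ_iff.1 h
  have hlen := length_of_mem_level (mem_prune_iff.1 hσ).1
  rwa [List.take_append_of_le_length hlen.ge, List.take_of_length_le hlen.le]

theorem Survives.mem (hT : IsTree T) (hnil : [] ∈ T) {σ : List ℕ}
    (h : Survives Ψ u g T θ σ) : σ ∈ T :=
  let ⟨_, hτ, hστ⟩ := h _ le_rfl
  hT _ _ hστ (mem_of_mem_level hnil (mem_prune_iff.1 hτ).1)

/-- An unpruned string above `σ` on a late level certifies that `σ` splits there, so the value `i`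
is attained above `σ` on all large levels. The relevant strings have only finitely many truncations
to the length at which the value is already determined, so one truncation extends to all levels. -/
theorem Survives.exists_extension {σ : List ℕ} (h : Survives Ψ u g T θ σ) {i : ℕ} (hi : i < 2) :
    ∃ τ ∈ boundedStrings g (max (σ.length + 1) (u (θ σ))), σ <+: τ ∧
      Ψ (τ.take (u (θ σ))) (θ σ) = some i ∧ Survives Ψ u g T θ τ := by
  set N := max (σ.length + 1) (u (θ σ)) with hN
  have hN1 : σ.length + 1 ≤ N := le_max_left _ _
  have hN2 : u (θ σ) ≤ N := le_max_right _ _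
  have key : ∀ M, N ≤ M → ∃ ρ ∈ prune Ψ u θ M (level Ψ u g T θ M), σ <+: ρ ∧
      Ψ (ρ.take (u (θ σ))) (θ σ) = some i := by
    intro M hM
    -- The splitting strings belong to level `M + 1` before it is pruned; only their truncations to
    -- length `M` are known to be unpruned. This is why one extra level is used.
    obtain ⟨ρ, hρ, hσρ⟩ := h (M + 1) (by omega)
    have hs := (mem_prune_iff.1 hρ).2 σ.length (by omega)
    rw [← List.prefix_iff_eq_take.1 hσρ] at hs
    obtain ⟨τ, hτ, hστ, hΨ⟩ := hs (by omega) i hi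
    refine ⟨τ.take M, take_mem_prune_of_mem_level hτ, ?_, ?_⟩
    · exact List.prefix_take_iff.2 ⟨hστ, by omega⟩
    · rwa [List.take_take, min_eq_left (by omega)]
  -- Otherwise each of the finitely many candidates of length `N` dies by some stage, and a level
  -- beyond all these stages contradicts `key`.
  by_contra! hcon
  have hfail : ∀ τ ∈ boundedStrings g N, ∃ s, N ≤ s ∧ (σ <+: τ → Ψ (τ.take (u (θ σ))) (θ σ) = some i →
      ∀ ρ ∈ prune Ψ u θ s (level Ψ u g T θ s), ¬ τ <+: ρ) := by
    intro τ hτ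
    by_cases h1 : σ <+: τ ∧ Ψ (τ.take (u (θ σ))) (θ σ) = some i
    · have := hcon τ hτ h1.1 h1.2
      rw [Survives, length_of_mem_boundedStrings hτ] at this
      push Not at this
      obtain ⟨s, hs, hs'⟩ := this
      exact ⟨s, hs, fun _ _ => hs'⟩
    · exact ⟨N, le_rfl, fun h2 h3 => (h1 ⟨h2, h3⟩).elim⟩
  choose! s hsN hs using hfail
  obtain ⟨M, hM⟩ : ∃ M, ∀ τ ∈ boundedStrings g N, s τ ≤ M :=
    ⟨(boundedStrings g N).toFinset.sup s, fun τ hτ => Finset.le_sup (List.mem_toFinset.2 hτ)⟩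
  obtain ⟨ρ, hρ, hσρ, hΨ⟩ := key (max N M) (le_max_left _ _)
  have hmem := mem_boundedStrings_of_mem_level
    (mem_prune_iff.1 (take_mem_prune_level (le_max_left N M) hρ)).1
  refine hs _ hmem (List.prefix_take_iff.2 ⟨hσρ, by omega⟩)
    (by rwa [List.take_take, min_eq_left hN2]) _
    (take_mem_prune_level ((hM _ hmem).trans (le_max_right N M)) hρ) ?_
  exact List.take_prefix_take_left (hsN _ hmem)

/-! ### Computability of the levels -/

section Computability

variable {α : Type*} [Primcodable α] {O : Set (ℕ →. ℕ)}

theorem DecidableIn.exists_extension (hΨ : Computable fun p : List ℕ × ℕ => Ψ p.1 p.2)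
    (hu : Computable u) {C : α → List (List ℕ)} {σ : α → List ℕ} {e : α → ℕ}
    (hC : ComputableIn O C) (hσ : ComputableIn O σ) (he : ComputableIn O e) {i : α → ℕ}
    (hi : ComputableIn O i) :
    DecidableIn O fun a => ∃ τ ∈ C a, σ a <+: τ ∧ Ψ (τ.take (u (e a))) (e a) = some (i a) :=
  have he' : ComputableIn O fun q : α × List ℕ => e q.1 := he.comp .fst
  have htake : ComputableIn O fun q : α × List ℕ => q.2.take (u (e q.1)) :=
    .list_take (hu.computableIn.comp he') .snd
  have hval : ComputableIn O fun q : α × List ℕ => Ψ (q.2.take (u (e q.1))) (e q.1) :=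
    hΨ.computableIn.comp (htake.pair he')
  have hsome : ComputableIn O fun q : α × List ℕ => some (i q.1) :=
    Primrec.option_some.computableIn.comp (hi.comp .fst)
  .exists_mem (P := fun a τ => σ a <+: τ ∧ Ψ (τ.take (u (e a))) (e a) = some (i a)) hC
    ((DecidableIn.isPrefix (hσ.comp .fst) .snd).and (.eq hval hsome))

theorem DecidableIn.splits (hΨ : Computable fun p : List ℕ × ℕ => Ψ p.1 p.2)
    (hu : Computable u) {C : α → List (List ℕ)} {σ : α → List ℕ} {e s : α → ℕ}
    (hC : ComputableIn O C) (hσ : ComputableIn O σ) (he : ComputableIn O e)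
    (hs : ComputableIn O s) : DecidableIn O fun a => Splits Ψ u (C a) (σ a) (e a) (s a) :=
  (DecidableIn.le (hu.computableIn.comp he) hs).imp
    (.forall_lt (P := fun a i => ∃ τ ∈ C a, σ a <+: τ ∧ Ψ (τ.take (u (e a))) (e a) = some i)
      (.const 2)
      (.exists_extension hΨ hu (hC.comp .fst) (hσ.comp .fst) (he.comp .fst) .snd))

theorem computableIn_prune (hΨ : Computable fun p : List ℕ × ℕ => Ψ p.1 p.2)
    (hu : Computable u) {C : α → List (List ℕ)} {θ : α → List ℕ → ℕ} {s : α → ℕ}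
    (hC : ComputableIn O C) (hθ : ComputableIn O fun p : α × List ℕ => θ p.1 p.2)
    (hs : ComputableIn O s) : ComputableIn O fun a => prune Ψ u (θ a) (s a) (C a) := by
  classical
  have htake : ComputableIn O fun q : (α × List ℕ) × ℕ => q.1.2.take q.2 :=
    .list_take .snd (ComputableIn.snd.comp .fst)
  have h1 : ComputableIn O fun q : (α × List ℕ) × ℕ => q.1.1 := ComputableIn.fst.comp .fst
  have hθ' : ComputableIn O fun q : (α × List ℕ) × ℕ => θ q.1.1 (q.1.2.take q.2) :=
    hθ.comp (h1.pair htake)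
  have hall : DecidableIn O fun q : α × List ℕ => ∀ l < s q.1 + 1,
      Splits Ψ u (C q.1) (q.2.take l) (θ q.1 (q.2.take l)) (s q.1) :=
    .forall_lt (P := fun (q : α × List ℕ) l =>
        Splits Ψ u (C q.1) (q.2.take l) (θ q.1 (q.2.take l)) (s q.1))
      (ComputableIn.succ.comp (hs.comp .fst))
      (.splits hΨ hu (hC.comp h1) htake hθ' (hs.comp h1))
  exact (DecidableIn.list_filter (P := fun a τ => ∀ l < s a + 1,
    Splits Ψ u (C a) (τ.take l) (θ a (τ.take l)) (s a)) hC hall).of_eq fun a => by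
      rw [prune]

theorem computableIn_levelStep (hΨ : Computable fun p : List ℕ × ℕ => Ψ p.1 p.2)
    (hu : Computable u) (hg : Computable g) (hT : DecidableIn O fun σ => σ ∈ T)
    {C : α → List (List ℕ)} {θ : α → List ℕ → ℕ} {s : α → ℕ}
    (hC : ComputableIn O C) (hθ : ComputableIn O fun p : α × List ℕ => θ p.1 p.2)
    (hs : ComputableIn O s) :
    ComputableIn O fun a => levelStep Ψ u g T (θ a) (s a) (C a) := by
  classical
  exact (DecidableIn.list_filter (P := fun _ τ => τ ∈ T)
    (ComputableIn.flatMap_children (computableIn_prune hΨ hu hC hθ hs) (hg.computableIn.comp hs))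
    (hT.comp .snd)).of_eq fun a => by rw [levelStep]

theorem computableIn_level (hΨ : Computable fun p : List ℕ × ℕ => Ψ p.1 p.2)
    (hu : Computable u) (hg : Computable g) (hT : DecidableIn O fun σ => σ ∈ T)
    {θ : α → List ℕ → ℕ} {s : α → ℕ}
    (hθ : ComputableIn O fun p : α × List ℕ => θ p.1 p.2) (hs : ComputableIn O s) :
    ComputableIn O fun a => level Ψ u g T (θ a) (s a) :=
  have h1 : ComputableIn O fun q : (α × ℕ × List (List ℕ)) × List ℕ => q.1.1 :=
    ComputableIn.fst.comp .fst
  have hstep : ComputableIn O fun p : α × ℕ × List (List ℕ) =>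
      levelStep Ψ u g T (θ p.1) p.2.1 p.2.2 :=
    computableIn_levelStep (θ := fun p : α × ℕ × List (List ℕ) => θ p.1) hΨ hu hg hT
      (ComputableIn.snd.comp .snd) (hθ.comp (h1.pair .snd)) (ComputableIn.fst.comp .snd)
  .nat_rec (g := fun _ => [[]]) (h := fun a s C => levelStep Ψ u g T (θ a) s C) hs (.const _) hstep

end Computability

end Pruning

theorem ComputableIn.comp₂ {α β γ σ : Type*} [Primcodable α] [Primcodable β] [Primcodable γ]
    [Primcodable σ] {O : Set (ℕ →. ℕ)} {f : β → γ → σ} {g : α → β} {h : α → γ}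
    (hf : ComputableIn O fun p : β × γ => f p.1 p.2) (hg : ComputableIn O g)
    (hh : ComputableIn O h) : ComputableIn O fun a => f (g a) (h a) :=
  hf.comp (hg.pair hh)

/-! ### Self-referential indices and the path that is never pruned -/

section SelfReference

variable {Ψ : List ℕ → ℕ → Option ℕ} {u g w y z : ℕ → ℕ} {T : Set (List ℕ)}

open scoped Classical in
/-- By the recursion theorem there are indices `θ σ` such that `Φ_{θ σ}` waits for a stage at which
`σ` fails to split, and then outputs a value that `σ` can take. -/
theorem exists_selfReferential_indices (hΨ : Computable fun p : List ℕ × ℕ => Ψ p.1 p.2)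
    (hu : Computable u) (hg : Computable g) (hT : DecidableIn (oracleOf y) fun σ => σ ∈ T) :
    ∃ θ : List ℕ → ℕ, Computable θ ∧ ∀ σ m v, v ∈ turingFunctional (θ σ) y m ↔
      ∃ s, (σ.length ≤ s ∧ ¬ Splits Ψ u (level Ψ u g T θ s) σ (θ σ) s) ∧
        (∀ t < s, ¬ (σ.length ≤ t ∧ ¬ Splits Ψ u (level Ψ u g T θ t) σ (θ σ) t)) ∧
        v = if ∃ τ ∈ level Ψ u g T θ s, σ <+: τ ∧ Ψ (τ.take (u (θ σ))) (θ σ) = some 1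
          then 1 else 0 := by
  -- Once `n` is the program's own index, `θ n σ` is an index of the constant function whose value
  -- is the result for `σ`. The program can thus construct the levels, which depend on the indices
  -- of all strings.
  let θ : ℕ → List ℕ → ℕ := fun n σ => OracleCode.appIndex n (Nat.pair n (Encodable.encode σ))
  have hθ : Computable fun p : ℕ × List ℕ => θ p.1 p.2 :=
    have hpair : Computable fun p : ℕ × List ℕ => Nat.pair p.1 (Encodable.encode p.2) :=
      Primrec₂.natPair.to_comp.comp .fst (Computable.encode.comp .snd)
    Computable.comp (g := fun p : ℕ × List ℕ => (p.1, Nat.pair p.1 (Encodable.encode p.2)))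
      OracleCode.primrec_appIndex.to_comp (Computable.fst.pair hpair)
  have hθ1 : ComputableIn (oracleOf y) fun q : ((ℕ × List ℕ) × ℕ) × List ℕ => θ q.1.1.1 q.2 :=
    .comp₂ hθ.computableIn (ComputableIn.fst.comp (ComputableIn.fst.comp .fst)) .snd
  have hlev : ComputableIn (oracleOf y) fun q : (ℕ × List ℕ) × ℕ =>
      level Ψ u g T (θ q.1.1) q.2 :=
    computableIn_level (θ := fun q : (ℕ × List ℕ) × ℕ => θ q.1.1) hΨ hu hg hT hθ1 .snd
  have hσ : ComputableIn (oracleOf y) fun q : (ℕ × List ℕ) × ℕ => q.1.2 :=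
    ComputableIn.snd.comp .fst
  have he : ComputableIn (oracleOf y) fun q : (ℕ × List ℕ) × ℕ => θ q.1.1 q.1.2 :=
    .comp₂ hθ.computableIn (ComputableIn.fst.comp .fst) hσ
  have hlen : ComputableIn (oracleOf y) fun q : (ℕ × List ℕ) × ℕ => q.1.2.length :=
    Computable.list_length.computableIn.comp hσ
  have hfail : DecidableIn (oracleOf y) fun q : (ℕ × List ℕ) × ℕ => q.1.2.length ≤ q.2 ∧
      ¬ Splits Ψ u (level Ψ u g T (θ q.1.1) q.2) q.1.2 (θ q.1.1 q.1.2) q.2 :=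
    (DecidableIn.le hlen .snd).and (DecidableIn.splits hΨ hu hlev hσ he .snd).not
  have hone : DecidableIn (oracleOf y) fun q : (ℕ × List ℕ) × ℕ =>
      ∃ τ ∈ level Ψ u g T (θ q.1.1) q.2,
        q.1.2 <+: τ ∧ Ψ (τ.take (u (θ q.1.1 q.1.2))) (θ q.1.1 q.1.2) = some 1 :=
    .exists_extension hΨ hu hlev hσ he (.const 1)
  obtain ⟨F, hF, hFspec⟩ := DecidableIn.rfind_map (α := ℕ × List ℕ)
    (P := fun p s => p.2.length ≤ s ∧ ¬ Splits Ψ u (level Ψ u g T (θ p.1) s) p.2 (θ p.1 p.2) s)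
    (g := fun p s => if ∃ τ ∈ level Ψ u g T (θ p.1) s,
      p.2 <+: τ ∧ Ψ (τ.take (u (θ p.1 p.2))) (θ p.1 p.2) = some 1 then 1 else 0)
    hfail (hone.ite (.const 1) (.const 0))
  have hdec : ComputableIn (oracleOf y) fun p : ℕ =>
      (p.unpair.1, ((Encodable.decode p.unpair.2 : Option (List ℕ)).getD [])) :=
    have hunpair : ComputableIn (oracleOf y) Nat.unpair := Primrec.unpair.computableIn
    (ComputableIn.fst.comp hunpair).pair
      (.option_getD (Computable.decode.computableIn.comp (ComputableIn.snd.comp hunpair))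
        (.const []))
  obtain ⟨n, hn⟩ := exists_selfIndex
    (F := fun n a => F (n, (Encodable.decode a : Option (List ℕ)).getD []))
    (RecursiveIn.comp (g := fun p : ℕ =>
      (p.unpair.1, ((Encodable.decode p.unpair.2 : Option (List ℕ)).getD []))) hF hdec)
  refine ⟨θ n, Computable.comp (g := fun σ : List ℕ => (n, σ)) hθ ((Computable.const n).pair .id),
    fun σ m v => ?_⟩
  change v ∈ turingFunctional (OracleCode.appIndex n (Nat.pair n (Encodable.encode σ))) y m ↔ _
  rw [hn, Encodable.encodek, Option.getD_some, hFspec]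

open scoped Classical in
-- Suppose `σ` on `w` fails to split, and take the first such stage `t`. By induction `w` is still
-- present on level `t`, so the value `z (θ σ)` is attained above `σ`. If `θ σ` outputs 1, then 1 is
-- attained and `z (θ σ) = 0` is attained too, so `σ` splits after all. If it outputs 0, then 1 is
-- not attained, yet `z (θ σ) = 1` is.
theorem initialSegment_mem_prune_level {θ : List ℕ → ℕ} (hwT : ∀ n, initialSegment w n ∈ T)
    (hwg : ∀ n, w n ≤ g n) (hΨ : ∀ n, Ψ (initialSegment w (u n)) n = some (z n))
    (hz : AvoidsDiagonal z y)
    (hθ : ∀ σ m v, v ∈ turingFunctional (θ σ) y m ↔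
      ∃ s, (σ.length ≤ s ∧ ¬ Splits Ψ u (level Ψ u g T θ s) σ (θ σ) s) ∧
        (∀ t < s, ¬ (σ.length ≤ t ∧ ¬ Splits Ψ u (level Ψ u g T θ t) σ (θ σ) t)) ∧
        v = if ∃ τ ∈ level Ψ u g T θ s, σ <+: τ ∧ Ψ (τ.take (u (θ σ))) (θ σ) = some 1
          then 1 else 0) (s : ℕ) :
    initialSegment w s ∈ prune Ψ u θ s (level Ψ u g T θ s) := by
  induction s using Nat.strong_induction_on with
  | _ s ih =>
    have hlev : ∀ t ≤ s, initialSegment w t ∈ level Ψ u g T θ t := by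
      rintro (- | t) ht
      · simp [mem_level_zero_iff, initialSegment]
      · exact mem_level_succ_iff.2 ⟨⟨_, ih t ht, w t, hwg t, (initialSegment_succ w t).symm⟩,
          hwT _⟩
    refine mem_prune_iff.2 ⟨hlev s le_rfl, fun l hl => ?_⟩
    rw [take_initialSegment hl]
    set σ := initialSegment w l
    by_contra hfail
    have hex : ∃ t, σ.length ≤ t ∧ ¬ Splits Ψ u (level Ψ u g T θ t) σ (θ σ) t :=
      ⟨s, by rwa [length_initialSegment], hfail⟩
    obtain ⟨hlt, hsp⟩ := Nat.find_spec hex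
    have hts : Nat.find hex ≤ s := Nat.find_le ⟨by rwa [length_initialSegment], hfail⟩
    -- The program ignores its input, so it may be evaluated at its own index, where `z` avoids it.
    have hval := (hθ σ (θ σ) _).2 ⟨_, Nat.find_spec hex, fun t => Nat.find_min hex, rfl⟩
    generalize Nat.find hex = t at hlt hsp hts hval
    rw [Splits, Classical.not_imp] at hsp
    rw [length_initialSegment] at hlt
    have hzval : ∃ τ ∈ level Ψ u g T θ t, σ <+: τ ∧
        Ψ (τ.take (u (θ σ))) (θ σ) = some (z (θ σ)) :=
      ⟨_, hlev t hts, initialSegment_prefix hlt, by rw [take_initialSegment hsp.1, hΨ]⟩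
    have hne := hz.notMem (θ σ)
    rcases Nat.lt_succ_iff_lt_or_eq.1 (hz.lt_two (θ σ)) with h0 | h1
    · rw [Nat.lt_one_iff.1 h0] at hne hzval
      split_ifs at hval with h1
      · exact hsp.2 fun i hi => by interval_cases i <;> assumption
      · exact hne hval
    · rw [h1] at hne hzval
      rw [if_pos hzval] at hval
      exact hne hval

end SelfReference

/-- A perfect tree is obtained by iterating a function that gives two incompatible extensions of
a string. -/
theorem exists_isPerfectTree {z : ℕ → ℕ} {T : Set (List ℕ)} (hT : IsTree T)
    {P : List ℕ → Prop} (hPT : ∀ σ, P σ → σ ∈ T) (hnil : P [])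
    {next : List ℕ → ℕ → List ℕ}
    (hnext : ComputableIn (oracleOf z) fun p : List ℕ × ℕ => next p.1 p.2)
    (hP : ∀ σ, P σ → ∀ i < 2, P (next σ i) ∧ σ <+: next σ i ∧ σ.length < (next σ i).length)
    (hne : ∀ σ, P σ → ¬ next σ 0 <+: next σ 1 ∧ ¬ next σ 1 <+: next σ 0) :
    ∃ S ⊆ T, DecidableIn (oracleOf z) (fun σ => σ ∈ S) ∧ IsPerfectTree S := by
  let L : ℕ → List (List ℕ) := fun k =>
    Nat.rec [[]] (fun _ C => C.flatMap fun σ => (List.range 2).map (next σ)) k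
  have hLs : ∀ k τ, τ ∈ L (k + 1) ↔ ∃ σ ∈ L k, ∃ i < 2, next σ i = τ := by
    intro k τ
    change τ ∈ (L k).flatMap _ ↔ _
    simp
  have hLc : ComputableIn (oracleOf z) L := by
    have hmap : ComputableIn (oracleOf z) fun q : (ℕ × ℕ × List (List ℕ)) × List ℕ =>
        (List.range 2).map (next q.2) :=
      .list_map (h := fun q : (ℕ × ℕ × List (List ℕ)) × List ℕ => next q.2) (.const _)
        (.comp₂ hnext (ComputableIn.snd.comp .fst) .snd)
    have hstep : ComputableIn (oracleOf z) fun p : ℕ × ℕ × List (List ℕ) =>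
        p.2.2.flatMap fun σ => (List.range 2).map (next σ) :=
      .list_flatMap (h := fun (p : ℕ × ℕ × List (List ℕ)) σ => (List.range 2).map (next σ))
        (ComputableIn.snd.comp .snd) hmap
    exact ComputableIn.nat_rec (α := ℕ) (f := fun n => n) (g := fun _ => [[]])
      (h := fun _ _ C => C.flatMap fun σ => (List.range 2).map (next σ)) .id (.const _) hstep
  have hLP : ∀ k, ∀ τ ∈ L k, P τ ∧ k ≤ τ.length := by
    intro k
    induction k with
    | zero =>
      intro τ hτ
      obtain rfl : τ = [] := by simpa [L] using hτ
      exact ⟨hnil, le_rfl⟩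
    | succ k ih =>
      intro τ hτ
      obtain ⟨σ, hσ, i, hi, rfl⟩ := (hLs k τ).1 hτ
      obtain ⟨h1, -, h3⟩ := hP σ (ih σ hσ).1 i hi
      exact ⟨h1, by have := (ih σ hσ).2; omega⟩
  have hup : ∀ k m, k ≤ m → ∀ σ ∈ L k, ∃ τ ∈ L m, σ <+: τ := by
    intro k m hkm
    induction m, hkm using Nat.le_induction with
    | base => exact fun σ hσ => ⟨σ, hσ, List.prefix_rfl⟩
    | succ m hkm ih =>
      intro σ hσ
      obtain ⟨τ, hτ, hστ⟩ := ih σ hσ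
      exact ⟨_, (hLs m _).2 ⟨τ, hτ, 0, by norm_num, rfl⟩,
        hστ.trans (hP τ (hLP m τ hτ).1 0 (by norm_num)).2.1⟩
  have hdown : ∀ k m, k ≤ m → ∀ τ ∈ L m, ∃ σ ∈ L k, σ <+: τ := by
    intro k m hkm
    induction m, hkm using Nat.le_induction with
    | base => exact fun σ hσ => ⟨σ, hσ, List.prefix_rfl⟩
    | succ m hkm ih =>
      intro τ hτ
      obtain ⟨ρ, hρ, i, hi, rfl⟩ := (hLs m τ).1 hτ
      obtain ⟨σ, hσ, hσρ⟩ := ih ρ hρ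
      exact ⟨σ, hσ, hσρ.trans (hP ρ (hLP m ρ hρ).1 i hi).2.1⟩
  have hkey : ∀ k, ∀ τ ∈ L k, ∀ σ, σ <+: τ → ∃ ρ ∈ L σ.length, σ <+: ρ := by
    intro k τ hτ σ hστ
    rcases le_total k σ.length with h | h
    · obtain ⟨ρ, hρ, hτρ⟩ := hup k _ h τ hτ
      exact ⟨ρ, hρ, hστ.trans hτρ⟩
    · obtain ⟨ρ, hρ, hρτ⟩ := hdown _ k h τ hτ
      exact ⟨ρ, hρ, List.prefix_of_prefix_length_le hστ hρτ (hLP _ ρ hρ).2⟩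
  -- The strings in `L k` have length at least `k`, so membership of `σ` in the downward closure of
  -- all the `L k` can be decided by inspecting `L σ.length` alone.
  refine ⟨{σ | ∃ ρ ∈ L σ.length, σ <+: ρ}, ?_, ?_, ?_, ?_, ?_⟩
  · rintro σ ⟨ρ, hρ, hσρ⟩
    exact hT _ _ hσρ (hPT _ (hLP _ ρ hρ).1)
  · exact DecidableIn.exists_mem (P := fun σ ρ : List ℕ => σ <+: ρ)
      (hLc.comp Computable.list_length.computableIn) (.isPrefix .fst .snd)
  · rintro σ τ hστ ⟨ρ, hρ, hτρ⟩
    exact hkey _ ρ hρ σ (hστ.trans hτρ)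
  · exact ⟨[], [], by simp [L], List.prefix_rfl⟩
  · rintro σ ⟨ρ, hρ, hσρ⟩
    have hPρ := (hLP _ ρ hρ).1
    have hS : ∀ i < 2, next ρ i ∈ {σ | ∃ ρ ∈ L σ.length, σ <+: ρ} := fun i hi =>
      hkey (σ.length + 1) _ ((hLs _ _).2 ⟨ρ, hρ, i, hi, rfl⟩) _ List.prefix_rfl
    exact ⟨_, hS 0 (by norm_num), _, hS 1 (by norm_num),
      hσρ.trans (hP ρ hPρ 0 (by norm_num)).2.1, hσρ.trans (hP ρ hPρ 1 (by norm_num)).2.1,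
      hne ρ hPρ⟩

theorem AvoidsDiagonal.exists_choice_primcodable {α : Type*} [Primcodable α] [Inhabited α]
    {y z : ℕ → ℕ} (h : AvoidsDiagonal z y) {R : α → ℕ → ℕ → Prop}
    (hR : DecidableIn (oracleOf y) fun p : α × ℕ × ℕ => R p.1 p.2.1 p.2.2) {b : α → ℕ}
    (hb : Computable b) : ∃ G : α → ℕ, ComputableIn (oracleOf z) G ∧
      ∀ a, (∃ i < b a, ∀ s, R a i s) → G a < b a ∧ ∀ s, R a (G a) s := by
  have hdec : Computable fun n : ℕ => (Encodable.decode n : Option α).getD default :=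
    Computable.option_getD .decode (.const _)
  have hR' : DecidableIn (oracleOf y) fun p : ℕ × ℕ × ℕ =>
      R ((Encodable.decode p.1 : Option α).getD default) p.2.1 p.2.2 :=
    hR.comp (f := fun p : ℕ × ℕ × ℕ =>
        ((Encodable.decode p.1 : Option α).getD default, p.2.1, p.2.2))
      ((hdec.computableIn.comp .fst).pair .snd)
  obtain ⟨G, hG, hGspec⟩ := h.exists_choice
    (R := fun n => R ((Encodable.decode n : Option α).getD default)) hR' (hb.comp hdec)
  refine ⟨fun a => G (Encodable.encode a), hG.comp Computable.encode.computableIn, fun a ha => ?_⟩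
  simpa using hGspec (Encodable.encode a) (by simpa using ha)

/-- If a tree recursive in `y` has a recursively bounded path that computes, with a recursive bound
on the use, some `z` that avoids the diagonal of `y`, then it has a perfect subtree recursive
in `z`. -/
theorem exists_isPerfectTree_of_path {y z w g u : ℕ → ℕ} {T : Set (List ℕ)}
    {Ψ : List ℕ → ℕ → Option ℕ} (hz : AvoidsDiagonal z y) (hT : IsTree T)
    (hTd : DecidableIn (oracleOf y) fun σ => σ ∈ T) (hwT : ∀ n, initialSegment w n ∈ T)
    (hg : Computable g) (hwg : ∀ n, w n ≤ g n)
    (hΨc : Computable fun p : List ℕ × ℕ => Ψ p.1 p.2) (hu : Computable u)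
    (hΨ : ∀ n, Ψ (initialSegment w (u n)) n = some (z n)) :
    ∃ S ⊆ T, DecidableIn (oracleOf z) (fun σ => σ ∈ S) ∧ IsPerfectTree S := by
  obtain ⟨θ, hθc, hθ⟩ := exists_selfReferential_indices hΨc hu hg hTd
  have hpath := initialSegment_mem_prune_level hwT hwg hΨ hz hθ
  have hnil : [] ∈ T := hwT 0
  let N : List ℕ → ℕ := fun σ => max (σ.length + 1) (u (θ σ))
  have hN : Computable N :=
    Primrec.nat_max.to_comp.comp (Computable.succ.comp .list_length) (hu.comp hθc)
  -- A recursive bound on the number of candidates is enough; the zero oracle serves to pass from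
  -- relative to plain computability.
  obtain ⟨K, hK, hKle⟩ := hyperimmuneFree_zero.exists_le
    (f := fun n => (boundedStrings g n).length)
    (Computable.list_length.computableIn.comp (computable_boundedStrings hg))
  let cand : List ℕ → ℕ → List ℕ := fun σ j => (boundedStrings g (N σ))[j]?.getD []
  have hcand : ∀ O, ComputableIn O fun p : List ℕ × ℕ => cand p.1 p.2 := fun O =>
    have hlist : ComputableIn O fun p : List ℕ × ℕ => boundedStrings g (N p.1) :=
      (computable_boundedStrings hg).comp (hN.computableIn.comp .fst)
    .option_getD (.comp₂ Computable.list_getElem?.computableIn hlist .snd) (.const [])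
  -- The quantifier over the singleton `[τ]` puts the condition in the form covered by
  -- `DecidableIn.exists_extension`. The default candidate `[]` is never good, since `N σ` is
  -- positive.
  let Good : List ℕ → ℕ → List ℕ → Prop := fun σ i τ =>
    τ.length = N σ ∧ ∃ ρ ∈ [τ], σ <+: ρ ∧ Ψ (ρ.take (u (θ σ))) (θ σ) = some i
  -- Over all `s` this says that the `j`-th candidate is a good extension that survives, a Π⁰₁(y)
  -- statement; `z` can therefore choose `j`.
  let R : List ℕ × ℕ → ℕ → ℕ → Prop := fun a j s =>
    Good a.1 a.2 (cand a.1 j) ∧ ((cand a.1 j).length ≤ s →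
      ∃ τ ∈ prune Ψ u θ s (level Ψ u g T θ s), cand a.1 j <+: τ)
  have hR : DecidableIn (oracleOf y) fun p : (List ℕ × ℕ) × ℕ × ℕ => R p.1 p.2.1 p.2.2 := by
    have hσ : ComputableIn (oracleOf y) fun p : (List ℕ × ℕ) × ℕ × ℕ => p.1.1 :=
      ComputableIn.fst.comp .fst
    have hi : ComputableIn (oracleOf y) fun p : (List ℕ × ℕ) × ℕ × ℕ => p.1.2 :=
      ComputableIn.snd.comp .fst
    have hs : ComputableIn (oracleOf y) fun p : (List ℕ × ℕ) × ℕ × ℕ => p.2.2 :=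
      ComputableIn.snd.comp .snd
    have hc : ComputableIn (oracleOf y) fun p : (List ℕ × ℕ) × ℕ × ℕ => cand p.1.1 p.2.1 :=
      .comp₂ (hcand _) hσ (ComputableIn.fst.comp .snd)
    have hlen : ComputableIn (oracleOf y) fun p : (List ℕ × ℕ) × ℕ × ℕ =>
        (cand p.1.1 p.2.1).length := Computable.list_length.computableIn.comp hc
    have hone : ComputableIn (oracleOf y) fun p : (List ℕ × ℕ) × ℕ × ℕ => [cand p.1.1 p.2.1] :=
      .list_concat (.const []) hc
    have hθ1 : ∀ {α : Type} [Primcodable α],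
        ComputableIn (oracleOf y) fun p : α × List ℕ => θ p.2 := hθc.computableIn.comp .snd
    have hlev : ComputableIn (oracleOf y) fun p : (List ℕ × ℕ) × ℕ × ℕ =>
        level Ψ u g T θ p.2.2 := computableIn_level (θ := fun _ => θ) hΨc hu hg hTd hθ1 hs
    have hpr : ComputableIn (oracleOf y) fun p : (List ℕ × ℕ) × ℕ × ℕ =>
        prune Ψ u θ p.2.2 (level Ψ u g T θ p.2.2) :=
      computableIn_prune (θ := fun _ => θ) hΨc hu hlev hθ1 hs
    have hex : DecidableIn (oracleOf y) fun p : (List ℕ × ℕ) × ℕ × ℕ =>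
        ∃ τ ∈ prune Ψ u θ p.2.2 (level Ψ u g T θ p.2.2), cand p.1.1 p.2.1 <+: τ :=
      .exists_mem (P := fun (p : (List ℕ × ℕ) × ℕ × ℕ) τ => cand p.1.1 p.2.1 <+: τ) hpr
        (.isPrefix (hc.comp .fst) .snd)
    exact ((DecidableIn.eq hlen (hN.computableIn.comp hσ)).and
      (.exists_extension hΨc hu hone hσ (hθc.computableIn.comp hσ) hi)).and
        ((DecidableIn.le hlen hs).imp hex)
  obtain ⟨G, hG, hGspec⟩ := hz.exists_choice_primcodable hR
    (b := fun a => K (N a.1)) (hK.comp (hN.comp .fst))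
  let next : List ℕ → ℕ → List ℕ := fun σ i => cand σ (G (σ, i))
  have hnext : ∀ σ, Survives Ψ u g T θ σ → ∀ i < 2,
      Good σ i (next σ i) ∧ Survives Ψ u g T θ (next σ i) := by
    intro σ hσ i hi
    obtain ⟨τ, hτ, hστ, hval, hsurv⟩ := hσ.exists_extension hi
    obtain ⟨j, hj, rfl⟩ := List.mem_iff_getElem.1 hτ
    have hcj : cand σ j = (boundedStrings g (N σ))[j]'hj := by
      simp only [cand]
      rw [List.getElem?_eq_getElem hj, Option.getD_some]
    have := (hGspec (σ, i) ⟨j, hj.trans_le (hKle _), fun s => ?_⟩).2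
    · exact ⟨(this 0).1, fun s => (this s).2⟩
    · refine ⟨⟨?_, _, List.mem_singleton_self _, ?_⟩, fun hs => ?_⟩
      · exact hcj ▸ length_of_mem_boundedStrings hτ
      · exact hcj ▸ ⟨hστ, hval⟩
      · rw [hcj] at hs ⊢
        exact hsurv s hs
  refine exists_isPerfectTree hT (P := Survives Ψ u g T θ) (fun σ hσ => hσ.mem hT hnil)
    (fun s _ => ⟨_, hpath s, List.nil_prefix⟩) (next := next)
    (.comp₂ (f := cand) (g := fun p : List ℕ × ℕ => p.1) (hcand _) .fst hG) (fun σ hσ i hi => ?_) fun σ hσ => ?_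
  · obtain ⟨⟨hlen, ρ, hρ, hσρ, -⟩, hsurv⟩ := hnext σ hσ i hi
    rw [List.mem_singleton.1 hρ] at hσρ
    exact ⟨hsurv, hσρ, hlen ▸ Nat.lt_of_succ_le (le_max_left _ _)⟩
  · obtain ⟨⟨hlen, ρ, hρ, -, hval⟩, -⟩ := hnext σ hσ 0 (by norm_num)
    obtain ⟨⟨hlen', ρ', hρ', -, hval'⟩, -⟩ := hnext σ hσ 1 (by norm_num)
    rw [List.mem_singleton.1 hρ] at hval
    rw [List.mem_singleton.1 hρ'] at hval'
    -- The two strings differ because they give different values at `θ σ`; having equal length, they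
    -- are incompatible.
    have hne : next σ 0 ≠ next σ 1 := fun h => by
      rw [h, hval'] at hval
      simp at hval
    exact ⟨fun h => hne (h.eq_of_length (hlen.trans hlen'.symm)),
      fun h => hne (h.eq_of_length (hlen'.trans hlen.symm)).symm⟩

/-- Cofinality is applied to a single real, some `z` in the model that avoids the diagonal of the
oracle for `T`. Hyperimmune-freeness is applied to the path obtained, to bound both its values and
the use of its computation of `z`. -/
theorem omegaWMPT_generatedBy {x : ℕ → ℕ → ℕ} (hx : ∀ n, HyperimmuneFree (x n))
    (hz : ∀ n, ∃ m z, RealReducible z (x m) ∧ AvoidsDiagonal z (x n)) :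
    OmegaWMPT (generatedBy x) := by
  intro T hTmem hT hcof
  obtain ⟨n, hTn⟩ := stringSetMem_generatedBy_iff.1 hTmem
  obtain ⟨m, z, hzm, hzn⟩ := hz n
  obtain ⟨w, hw, hwT, hzw⟩ := hcof z (realMem_generatedBy_iff.2 ⟨m, hzm⟩)
  obtain ⟨k, hwk⟩ := realMem_generatedBy_iff.1 hw
  obtain ⟨A, hA, hAmono, hAspec⟩ := OracleCode.exists_approx
  obtain ⟨e, he⟩ := OracleCode.exists_turingFunctional_eq hzw
  have hval : ∀ n, ∃ s, A e (initialSegment w s) n = some (z n) := fun n =>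
    (hAspec e w n _).1 (by rw [he]; simp)
  have hAc : ComputableIn (oracleOf (x k)) fun p : ℕ × ℕ => A e (initialSegment w p.2) p.1 :=
    hA.computableIn.comp (f := fun p : ℕ × List ℕ × ℕ => A p.1 p.2.1 p.2.2)
      (g := fun p : ℕ × ℕ => (e, initialSegment w p.2, p.1)) ((ComputableIn.const e).pair
        (((ComputableIn.initialSegment hwk).comp .snd).pair .fst))
  -- The function `U` measures how much of `w` is needed for convergence at `n`. By monotonicity of
  -- the approximation, any larger recursive bound `u` serves as well.
  obtain ⟨U, hU, hUspec⟩ := DecidableIn.find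
    (P := fun n s => ¬ A e (initialSegment w s) n = none) (DecidableIn.eq hAc (.const none)).not
    fun n => (hval n).imp fun s hs => by simp [hs]
  obtain ⟨u, hu, hUu⟩ := (hx k).exists_le hU
  obtain ⟨g, hg, hwg⟩ := (hx k).exists_le hwk
  obtain ⟨S, hST, hS, hperf⟩ := exists_isPerfectTree_of_path (Ψ := A e) hzn hT hTn hwT hg hwg
    (Computable.comp (g := fun p : List ℕ × ℕ => (e, p)) hA ((Computable.const e).pair .id)) hu
    fun n => by
      obtain ⟨v, hv⟩ := Option.ne_none_iff_exists'.1 (hUspec n).1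
      obtain ⟨s, hs⟩ := hval n
      have h1 := hAmono _ _ _ _ _ (initialSegment_prefix (hUu n)) hv
      have h2 := hAmono _ _ _ _ _ (initialSegment_prefix (le_max_left (u n) s)) h1
      have h3 := hAmono _ _ _ _ _ (initialSegment_prefix (le_max_right (u n) s)) hs
      rw [h1, ← h2, h3]
  exact ⟨S, stringSetMem_generatedBy_iff.2 ⟨m, hS.trans hzm⟩, hST, hperf⟩

/-! ### The chain and the main theorem -/

theorem exists_hyperimmuneFree_chain : ∃ x : ℕ → ℕ → ℕ, x 0 = (fun _ => 0) ∧
    (∀ n, HyperimmuneFree (x n)) ∧ ∀ n, AvoidsDiagonal (x (n + 1)) (x n) := by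
  choose f hf hfd using fun y : {x // HyperimmuneFree x} => y.2.exists_avoidsDiagonal
  let x : ℕ → {x // HyperimmuneFree x} := fun n =>
    Nat.rec ⟨_, hyperimmuneFree_zero⟩ (fun _ y => ⟨f y, hf y⟩) n
  exact ⟨fun n => (x n).1, rfl, fun n => (x n).2, fun n => hfd (x n)⟩

theorem mainTheorem4 :
    (∃ x : ℕ → ℕ → ℕ,
      x 0 = (fun _ => 0) ∧
      (∀ n, HyperimmuneFree (x n)) ∧
      (∀ n, PADominates (x (n + 1)) (x n)) ∧
      (omegaModel (generatedBy x) (generatedBy_nonempty x)).WKL0 ∧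
      OmegaWMPT (generatedBy x) ∧
      ¬ (omegaModel (generatedBy x) (generatedBy_nonempty x)).ACA0) ∧
    (∀ φ : L2Formula,
      (∀ (I : Set (Set ℕ)) (hI : I.Nonempty), (omegaModel I hI).RCA0 →
        ((omegaModel I hI).Models φ ↔ OmegaWMPT I)) →
      ¬ ∀ M : L2Structure, M.WKL0 → M.Models φ → M.ACA0) := by
  obtain ⟨x, hx0, hx, hdiag⟩ := exists_hyperimmuneFree_chain
  have hmono : ∀ m n, m ≤ n → RealReducible (x m) (x n) := fun m n hmn => by
    induction n, hmn using Nat.le_induction with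
    | base => exact computableIn_oracleOf _
    | succ n _ ih => exact ih.trans (hdiag n).realReducible
  have hz : ∀ n, ∃ m z, RealReducible z (x m) ∧ AvoidsDiagonal z (x n) := fun n =>
    ⟨n + 1, _, computableIn_oracleOf _, hdiag n⟩
  have hWKL := wkl0_generatedBy hmono hz
  have hMPT := omegaWMPT_generatedBy hx hz
  have hACA : ¬ (omegaModel (generatedBy x) (generatedBy_nonempty x)).ACA0 := fun h =>
    not_arithmeticalComprehension_generatedBy hx h.comprehension
  exact ⟨⟨x, hx0, hx, fun n => ⟨_, computableIn_oracleOf _, (hdiag n).lt_two, (hdiag n).notMem⟩,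
    hWKL, hMPT, hACA⟩, fun φ hφ h =>
      hACA (h _ hWKL ((hφ _ (generatedBy_nonempty x) hWKL.rca0).2 hMPT))⟩
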